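/- Let $\mathfrak g$ be the exotic conformal Galilei algebra: the complex Lie algebra with basis $D,H,C,J_{12},\Theta_0,P_1,P_2,K_1,K_2,F_1,F_2$ whose non-zero brackets are $$[D,H]=H,\quad [C,D]=C,\quad [C,H]=2D,$$ $$[H,K_i]=-P_i,\quad [D,P_i]=P_i,\quad [C,P_i]=2K_i,\quad [H,F_i]=-2K_i,\quad [D,F_i]=-F_i,\quad [C,K_i]=F_i,$$ $$[J_{12},X_1]=X_2,\quad [J_{12},X_2]=-X_1\ (X=P,K,F),\quad [K_i,K_j]=\epsilon_{ij}\Theta_0,\quad [P_i,F_j]=-2\epsilon_{ij}\Theta_0,$$ with $\epsilon_{12}=-\epsilon_{21}=1$, $\epsilon_{11}=\epsilon_{22}=0$ (together with those that follow by antisymmetry). Put $X_\pm=X_1\pm iX_2$ for $X=P,K,F$, $J=iJ_{12}$, $\Theta=i\Theta_0$, and let $\mathfrak g^-$ be the subalgebra spanned by $C,F_+,F_-,K_-$. For $d,r,\theta\in\mathbb C$, a highest weight vector of weight $(d,r,\theta)$ in a $\mathfrak g$-module is a non-zero vector $v$ with $Dv=dv$, $Jv=rv$, $\Theta v=\theta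 v$ and $Hv=P_\pm v=K_+v=0$. A highest weight module of weight $(d,r,\theta)$ is a $\mathfrak g$-module generated by such a vector. The Verma module $V^{d,r}$ is the quotient of $U(\mathfrak g)$ by the left ideal generated by $H,P_+,P_-,K_+,D-d,J-r,\Theta-\theta$, and $|d,r\rangle$ is the image of $1$. Theorem. Let $\theta\neq 0$ and let $d,r\in\mathbb C$ (in particular, $d$ and $r$ may be real). (i) If $2d+3\notin\{1,2,3,\dots\}$, then $V^{d,r}$ is an irreducible, infinite-dimensional highest weight module of weight $(d,r,\theta)$, and every irreducible highest weight module of weight $(d,r,\theta)$ is isomorphic to $V^{d,r}$. (ii) If $p=2d+3\in\{1,2,3,\dots\}$, then $|v_s\rangle=(2\theta C-K_-F_+)^{p}|d,r\rangle$ is a highest weight vector of weight $(d-p,r,\theta)$ in $V^{d,r}$ and the submodule that it generates is $U(\mathfrak g^-)|v_s\rangle$. The quotient $\tilde V^{d,r}=V^{d,r}/U(\mathfrak g^-)|v_s\rangle$ is an irreducible, infinite-dimensional highest weight module of weight $(d,r,\theta)$, and every irreducible highest weight module of weight $(d,r,\theta)$ is isomorphic to $\tilde V^{d,r}$. -/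

import Mathlib

noncomputable section

/-- Labels of the original generators of the exotic conformal Galilei algebra
(spin one, two space dimensions); `J` is the rotation `J₁₂`, and `Th` is the central charge `Θ`. -/
inductive ECGA.Gen : Type
  | D | H | C | J | Th | P1 | P2 | K1 | K2 | F1 | F2

open ECGA.Gen

/-- The underlying vector space of the (complexified) exotic conformal Galilei algebra:
an element is its family of coordinates in the original generators. -/
def ECGA : Type := ECGA.Gen → ℂ

namespace ECGA

instance : AddCommGroup ECGA := inferInstanceAs (AddCommGroup (Gen → ℂ))

instance : Module ℂ ECGA := inferInstanceAs (Module ℂ (Gen → ℂ))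

/-- The coefficient with which `⁅a, b⁆` occurs in the bracket of `x` and `y`. -/
def w (x y : ECGA) (a b : Gen) : ℂ := x a * y b - x b * y a

/-- The bilinear alternating bracket whose non-zero values on the generators are
`[D,H] = H`, `[C,D] = C`, `[C,H] = 2D`,
`[H,Kᵢ] = -Pᵢ`, `[D,Pᵢ] = Pᵢ`, `[C,Pᵢ] = 2Kᵢ`, `[H,Fᵢ] = -2Kᵢ`, `[D,Fᵢ] = -Fᵢ`, `[C,Kᵢ] = Fᵢ`,
`[J,X₁] = X₂`, `[J,X₂] = -X₁` for `X = P, K, F`,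
`[Kᵢ,Kⱼ] = εᵢⱼ Θ`, `[Pᵢ,Fⱼ] = -2 εᵢⱼ Θ`. -/
def bracket (x y : ECGA) : ECGA
  | D => 2 * w x y C H
  | H => w x y D H
  | C => w x y C D
  | J => 0
  | Th => w x y K1 K2 - 2 * w x y P1 F2 + 2 * w x y P2 F1
  | P1 => -w x y H K1 + w x y D P1 - w x y J P2
  | P2 => -w x y H K2 + w x y D P2 + w x y J P1
  | K1 => 2 * w x y C P1 - 2 * w x y H F1 - w x y J K2
  | K2 => 2 * w x y C P2 - 2 * w x y H F2 + w x y J K1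
  | F1 => -w x y D F1 + w x y C K1 - w x y J F2
  | F2 => -w x y D F2 + w x y C K2 + w x y J F1

instance : Bracket ECGA ECGA := ⟨bracket⟩

@[ext] theorem ext {x y : ECGA} (h : ∀ g, x g = y g) : x = y := funext h

theorem lie_def (x y : ECGA) : ⁅x, y⁆ = bracket x y := rfl

theorem add_apply (x y : ECGA) (g : Gen) : (x + y) g = x g + y g := rfl

theorem sub_apply (x y : ECGA) (g : Gen) : (x - y) g = x g - y g := rfl

theorem neg_apply (x : ECGA) (g : Gen) : (-x) g = -x g := rfl

theorem zero_apply (g : Gen) : (0 : ECGA) g = 0 := rfl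

theorem smul_apply (c : ℂ) (x : ECGA) (g : Gen) : (c • x) g = c * x g := rfl

instance : LieRing ECGA where
  add_lie x y z := by
    ext g; cases g <;> simp only [lie_def, add_apply, bracket, w] <;> ring
  lie_add x y z := by
    ext g; cases g <;> simp only [lie_def, add_apply, bracket, w] <;> ring
  lie_self x := by
    ext g; cases g <;> simp only [lie_def, zero_apply, bracket, w] <;> ring
  leibniz_lie x y z := by
    ext g; cases g <;> simp only [lie_def, add_apply, bracket, w] <;> ring

instance : LieAlgebra ℂ ECGA where
  lie_smul c x y := by
    ext g; cases g <;> simp only [lie_def, smul_apply, bracket, w] <;> ring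

open Classical in
/-- The generator with a given label. -/
def gen (g : Gen) : ECGA := fun g' => if g' = g then 1 else 0

/-! The generators adapted to the triangular decomposition: `X± = X₁ ± i X₂`, `J = i J₁₂`, and the
rescaled central element `i Θ`. -/

def gD : ECGA := gen D
def gH : ECGA := gen H
def gC : ECGA := gen C
def gJ : ECGA := Complex.I • gen J
def gTheta : ECGA := Complex.I • gen Th
def Pplus : ECGA := gen P1 + Complex.I • gen P2
def Pminus : ECGA := gen P1 - Complex.I • gen P2
def Kplus : ECGA := gen K1 + Complex.I • gen K2
def Kminus : ECGA := gen K1 - Complex.I • gen K2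
def Fplus : ECGA := gen F1 + Complex.I • gen F2
def Fminus : ECGA := gen F1 - Complex.I • gen F2

/-- `v` is a highest weight vector of highest weight `(d, r, θ)`: a non-zero simultaneous
eigenvector of `D`, `J`, `Θ` with eigenvalues `d`, `r`, `θ` that `H`, `P±`, `K₊` annihilate. -/
structure IsHighestWeightVector {M : Type*} [AddCommGroup M] [Module ℂ M] [LieRingModule ECGA M]
    (d r θ : ℂ) (v : M) : Prop where
  ne_zero : v ≠ 0
  lie_D : ⁅gD, v⁆ = d • v
  lie_J : ⁅gJ, v⁆ = r • v
  lie_Theta : ⁅gTheta, v⁆ = θ • v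
  lie_H : ⁅gH, v⁆ = 0
  lie_Pplus : ⁅Pplus, v⁆ = 0
  lie_Pminus : ⁅Pminus, v⁆ = 0
  lie_Kplus : ⁅Kplus, v⁆ = 0

/-- `M` is a highest weight module of highest weight `(d, r, θ)`: it is generated by a
highest weight vector of that weight. -/
def IsHighestWeightModule (M : Type*) [AddCommGroup M] [Module ℂ M] [LieRingModule ECGA M]
    (d r θ : ℂ) : Prop :=
  ∃ v : M, IsHighestWeightVector d r θ v ∧ LieSubmodule.lieSpan ℂ ECGA {v} = ⊤

/-- The universal enveloping algebra of the exotic conformal Galilei algebra. -/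
abbrev U : Type := UniversalEnvelopingAlgebra ℂ ECGA

/-- The inclusion of the Lie algebra in its enveloping algebra. -/
abbrev toU (x : ECGA) : U := UniversalEnvelopingAlgebra.ι ℂ x

/-- The left ideal of the enveloping algebra that is generated by
`H`, `P±`, `K₊`, `D - d`, `J - r`, `Θ - θ`. -/
def vermaIdeal (d r θ : ℂ) : Submodule U U :=
  Submodule.span U {toU gH, toU Pplus, toU Pminus, toU Kplus,
    toU gD - algebraMap ℂ U d, toU gJ - algebraMap ℂ U r, toU gTheta - algebraMap ℂ U θ}

/-- The Verma module of highest weight `(d, r, θ)`. -/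
def Verma (d r θ : ℂ) : Type := U ⧸ vermaIdeal d r θ

instance (d r θ : ℂ) : AddCommGroup (Verma d r θ) :=
  inferInstanceAs (AddCommGroup (U ⧸ vermaIdeal d r θ))

instance (d r θ : ℂ) : Module U (Verma d r θ) :=
  inferInstanceAs (Module U (U ⧸ vermaIdeal d r θ))

instance (d r θ : ℂ) : Module ℂ (Verma d r θ) :=
  inferInstanceAs (Module ℂ (U ⧸ vermaIdeal d r θ))

instance (d r θ : ℂ) : IsScalarTower ℂ U (Verma d r θ) :=
  inferInstanceAs (IsScalarTower ℂ U (U ⧸ vermaIdeal d r θ))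

theorem toU_lie (x y : ECGA) : toU ⁅x, y⁆ = toU x * toU y - toU y * toU x :=
  letI : LieRing U := LieRing.ofAssociativeRing
  LieHom.map_lie (UniversalEnvelopingAlgebra.ι ℂ) x y

/-- The Lie algebra acts on the Verma module by left multiplication. -/
instance (d r θ : ℂ) : LieRingModule ECGA (Verma d r θ) where
  bracket x v := toU x • v
  add_lie x y v := by
    change toU (x + y) • v = toU x • v + toU y • v
    rw [toU, map_add, add_smul]
  lie_add x v v' := smul_add (toU x) v v'
  leibniz_lie x y v := by
    change toU x • toU y • v = toU ⁅x, y⁆ • v + toU y • toU x • v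
    rw [toU_lie, sub_smul, mul_smul, mul_smul, sub_add_cancel]

instance (d r θ : ℂ) : LieModule ℂ ECGA (Verma d r θ) where
  smul_lie c x v := by
    change toU (c • x) • v = c • toU x • v
    rw [toU, map_smul, smul_assoc]
  lie_smul c x v := by
    change toU x • c • v = c • toU x • v
    rw [← algebraMap_smul U c v, ← algebraMap_smul U c (toU x • v), ← mul_smul, ← mul_smul,
      Algebra.commutes]

/-- The canonical highest weight vector `|d, r⟩` of the Verma module. -/
def Verma.ket (d r θ : ℂ) : Verma d r θ := Submodule.Quotient.mk (1 : U)

/-- The vector `(2θ C - K₋ F₊)^p |d, r⟩`. -/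
def singularVector (d r θ : ℂ) (p : ℕ) : Verma d r θ :=
  ((2 * θ) • toU gC - toU Kminus * toU Fplus) ^ p • Verma.ket d r θ

/-- The submodule of the Verma module generated by `(2θ C - K₋ F₊)^p |d, r⟩`. -/
def singularSubmodule (d r θ : ℂ) (p : ℕ) : LieSubmodule ℂ ECGA (Verma d r θ) :=
  LieSubmodule.lieSpan ℂ ECGA {singularVector d r θ p}

/-- The quotient of the Verma module by the submodule generated by
`(2θ C - K₋ F₊)^p |d, r⟩`. -/
abbrev VermaQuotient (d r θ : ℂ) (p : ℕ) : Type :=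
  Verma d r θ ⧸ singularSubmodule d r θ p

/-- The subalgebra `𝔤⁻`, spanned by `C`, `F₊`, `F₋`, `K₋`. -/
def gMinus : LieSubalgebra ℂ ECGA where
  __ := Submodule.span ℂ {gC, Fplus, Fminus, Kminus}
  lie_mem' {x y} hx hy := by
    change ⁅x, y⁆ ∈ Submodule.span ℂ {gC, Fplus, Fminus, Kminus}
    induction hx, hy using Submodule.span_induction₂ with
    | mem_mem a b ha hb =>
      have hF : Fminus ∈ Submodule.span ℂ {gC, Fplus, Fminus, Kminus} :=
        Submodule.subset_span (by simp)
      have key : ⁅a, b⁆ = 0 ∨ ⁅a, b⁆ = Fminus ∨ ⁅a, b⁆ = -Fminus := by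
        simp only [Set.mem_insert_iff, Set.mem_singleton_iff] at ha hb
        rcases ha with rfl | rfl | rfl | rfl <;> rcases hb with rfl | rfl | rfl | rfl
        all_goals first
          | left; ext g; cases g <;> simp only [lie_def, bracket, w] <;>
              simp [gC, Fplus, Fminus, Kminus, gen, add_apply, sub_apply, smul_apply, zero_apply]
            done
          | right; left; ext g; cases g <;> simp only [lie_def, bracket, w] <;>
              simp [gC, Fminus, Kminus, gen, sub_apply, smul_apply]
            done
          | right; right; ext g; cases g <;> simp only [lie_def, bracket, w] <;>
              simp [gC, Fminus, Kminus, gen, sub_apply, neg_apply, smul_apply]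
      rcases key with h | h | h <;> rw [h]
      exacts [zero_mem _, hF, neg_mem hF]
    | zero_left => rw [zero_lie]; exact zero_mem _
    | zero_right => rw [lie_zero]; exact zero_mem _
    | add_left _ _ _ _ _ _ h h' => rw [add_lie]; exact add_mem h h'
    | add_right _ _ _ _ _ _ h h' => rw [lie_add]; exact add_mem h h'
    | smul_left c _ _ _ _ h => rw [smul_lie]; exact Submodule.smul_mem _ c h
    | smul_right c _ _ _ _ h => rw [lie_smul]; exact Submodule.smul_mem _ c h

/-- The action of the enveloping algebra of `𝔤⁻` on a module over the whole algebra. -/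
def minusAction (M : Type*) [AddCommGroup M] [Module ℂ M] [LieRingModule ECGA M]
    [LieModule ℂ ECGA M] : UniversalEnvelopingAlgebra ℂ gMinus →ₐ[ℂ] Module.End ℂ M :=
  UniversalEnvelopingAlgebra.lift ℂ (LieModule.toEnd ℂ gMinus M)

end ECGA

end

noncomputable section

open ECGA.Gen

namespace ECGA

/-! Since Θ acts by θ ≠ 0, the operators F₋, F₊, K₋ and P₊, P₋, K₊ act as three pairs of creation
and annihilation operators of a Heisenberg algebra. Subtracting quadratic corrections in them
decouples the conformal sl₂: `lowering`, which is 2θC − K₋F₊ + K₊F₋, commutes with F± and K±, and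
2θH − P₋K₊ + P₊K₋ is the matching raising operator. The Verma module thus behaves as a Fock space
tensored with an sl₂ Verma module of shifted weight, and the sl₂ factor alone decides reducibility.

Concretely, the monomials F₋^a F₊^b K₋^c (`lowering`)^n |d,r⟩ form a basis. They span because their
span is stable under 𝔤⁻. They are independent because an explicit representation on families
f(a,b,c,n) yields a map `coeff` that separates them. In its normalisation, creation operators
multiply by an exponent and shift, annihilation operators are pure shifts, and the corrected raising
operator sends f to (n − 2d − 2) f(a,b,c,n+1), up to the scalar 2θ.

The factor n − 2d − 2 vanishes for some n ≥ 0 exactly when p = 2d + 3 is a positive integer, and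
then at n = p − 1. Hence the vectors supported in degrees n ≥ p form a submodule `maxSubmodule`,
which is zero in the other case. A submodule with a vector outside it contains |d,r⟩: shift a top
nonsingular monomial down to the vacuum, then separate by D-weight (`le_maxSubmodule`). So the
quotient by `maxSubmodule` is the unique simple quotient. The monomial with a = b = c = 0 and n = p
is the singular vector and generates `maxSubmodule` (`singularSubmodule_eq`). -/

/-- The coefficients of an element in the original generators determine it in terms of the
generators adapted to the triangular decomposition. -/
theorem eq_sum (x : ECGA) :
    x = x D • gD + x H • gH + x C • gC + (-Complex.I * x J) • gJ + (-Complex.I * x Th) • gTheta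
      + ((x P1 - Complex.I * x P2) / 2) • Pplus + ((x P1 + Complex.I * x P2) / 2) • Pminus
      + ((x K1 - Complex.I * x K2) / 2) • Kplus + ((x K1 + Complex.I * x K2) / 2) • Kminus
      + ((x F1 - Complex.I * x F2) / 2) • Fplus + ((x F1 + Complex.I * x F2) / 2) • Fminus := by
  ext g
  cases g <;> simp only [gD, gH, gC, gJ, gTheta, Pplus, Pminus, Kplus, Kminus, Fplus, Fminus, gen,
    add_apply, sub_apply, smul_apply, if_true, if_false, reduceCtorEq] <;> ring_nf <;>
    simp only [Complex.I_sq] <;> ring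

/-! ### The model representation on coefficient families -/

/-- The space on which the model representation lives: families of coefficients indexed by the
exponents of `F₋`, `F₊`, `K₋` and the commuting copy of `C`, where only non-negative exponents
matter in the end. -/
abbrev Coeff : Type := ℤ → ℤ → ℤ → ℤ → ℂ

/-- The operator by which an element of the algebra acts on coefficient families. -/
def modelFun (d r θ : ℂ) (x : ECGA) (f : Coeff) : Coeff := fun a b c n =>
  x D * ((d - a - b - n) * f a b c n)
  + x H * ((n - 2 * d - 2) * f a b c (n + 1) + 4 * θ * f a (b + 1) (c + 1) n
      - 2 * c * f (a + 1) b (c - 1) n)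
  + x C * (n * f a b c (n - 1) + b * c / (2 * θ) * f a (b - 1) (c - 1) n
      + a * f (a - 1) b (c + 1) n)
  + -Complex.I * x J * ((r - a + b - c) * f a b c n)
  + -Complex.I * x Th * (θ * f a b c n)
  + (x P1 - Complex.I * x P2) / 2 * (4 * θ * f (a + 1) b c n)
  + (x P1 + Complex.I * x P2) / 2 * (-4 * θ * f a (b + 1) c n)
  + (x K1 - Complex.I * x K2) / 2 * (-2 * θ * f a b (c + 1) n)
  + (x K1 + Complex.I * x K2) / 2 * (c * f a b (c - 1) n)
  + (x F1 - Complex.I * x F2) / 2 * (b * f a (b - 1) c n)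
  + (x F1 + Complex.I * x F2) / 2 * (a * f (a - 1) b c n)

/-- `modelFun` as a bilinear map. -/
def modelLin (d r θ : ℂ) : ECGA →ₗ[ℂ] Module.End ℂ Coeff :=
  LinearMap.mk₂ ℂ (modelFun d r θ)
    (fun x y f => by funext a b c n; simp only [modelFun, add_apply, Pi.add_apply]; ring)
    (fun s x f => by
      funext a b c n; simp only [modelFun, smul_apply, Pi.smul_apply, smul_eq_mul]; ring)
    (fun x f g => by funext a b c n; simp only [modelFun, Pi.add_apply]; ring)
    (fun s x f => by
      funext a b c n; simp only [modelFun, Pi.smul_apply, smul_eq_mul]; ring)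


/-- The generators adapted to the triangular decomposition. -/
def adapted : Set ECGA :=
  {gD, gH, gC, gJ, gTheta, Pplus, Pminus, Kplus, Kminus, Fplus, Fminus}

theorem span_adapted : Submodule.span ℂ adapted = ⊤ := by
  rw [eq_top_iff]
  rintro x -
  rw [eq_sum x]
  have h : ∀ (t : ℂ) {y : ECGA}, y ∈ adapted → t • y ∈ Submodule.span ℂ adapted :=
    fun t y hy => Submodule.smul_mem _ t (Submodule.subset_span hy)
  repeat' apply Submodule.add_mem
  all_goals exact h _ (by simp [adapted])

theorem modelLin_apply (d r θ : ℂ) (x : ECGA) (f : Coeff) :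
    modelLin d r θ x f = modelFun d r θ x f := rfl

-- By bilinearity it suffices to test pairs of adapted generators. With integer exponents shifts are
-- invertible, so every relation is a polynomial identity in the exponents, without boundary cases.
set_option linter.unusedSimpArgs false in
set_option maxHeartbeats 4000000 in
theorem modelLin_lie (d r : ℂ) {θ : ℂ} (hθ : θ ≠ 0) (x y : ECGA) :
    modelLin d r θ ⁅x, y⁆ =
      modelLin d r θ x * modelLin d r θ y - modelLin d r θ y * modelLin d r θ x := by
  have hx : x ∈ Submodule.span ℂ adapted := span_adapted ▸ Submodule.mem_top
  have hy : y ∈ Submodule.span ℂ adapted := span_adapted ▸ Submodule.mem_top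
  induction hx, hy using Submodule.span_induction₂ with
  | mem_mem x y hx hy =>
    simp only [adapted, Set.mem_insert_iff, Set.mem_singleton_iff] at hx hy
    ext f a b c n
    rcases hx with rfl | rfl | rfl | rfl | rfl | rfl | rfl | rfl | rfl | rfl | rfl <;>
    rcases hy with rfl | rfl | rfl | rfl | rfl | rfl | rfl | rfl | rfl | rfl | rfl <;>
    simp only [LinearMap.sub_apply, Module.End.mul_apply, Pi.sub_apply, Pi.zero_apply,
    modelLin_apply, modelFun, lie_def, bracket, w, gD, gH, gC, gJ, gTheta, Pplus, Pminus, Kplus, Kminus, Fplus, Fminus, gen,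
    add_apply, sub_apply, smul_apply, if_true, if_false, reduceCtorEq, mul_one, mul_zero,
    zero_mul, one_mul, sub_zero, zero_sub, neg_zero, add_zero, zero_add, sub_self, zero_div,
    add_sub_cancel_right, sub_add_cancel, mul_neg, neg_mul, Complex.I_mul_I, neg_neg,
    Int.cast_add, Int.cast_sub, Int.cast_one] <;>
    (try first | done | rfl | ring1 | (field_simp; done) | (field_simp; ring1) |
      (field_simp; ring_nf; simp only [Complex.I_sq]; ring1))
  | zero_left => simp
  | zero_right => simp
  | add_left x x' y _ _ _ h h' => rw [add_lie, map_add, map_add, h, h', add_mul, mul_add]; abel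
  | add_right x y y' _ _ _ h h' => rw [lie_add, map_add, map_add, h, h', add_mul, mul_add]; abel
  | smul_left t x y _ _ h =>
    rw [smul_lie, map_smul, map_smul, h, smul_mul_assoc, mul_smul_comm, smul_sub]
  | smul_right t x y _ _ h =>
    rw [lie_smul, map_smul, map_smul, h, smul_mul_assoc, mul_smul_comm, smul_sub]


attribute [local instance 100] LieRing.ofAssociativeRing

/-- The representation of the algebra on coefficient families. -/
def modelRep (d r : ℂ) {θ : ℂ} (hθ : θ ≠ 0) : ECGA →ₗ⁅ℂ⁆ Module.End ℂ Coeff where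
  __ := modelLin d r θ
  map_lie' {x y} := modelLin_lie d r hθ x y

/-! ### Enveloping algebras and orbits of highest weight vectors -/

theorem envelopingAlgebra_induction {L : Type*} [LieRing L] [LieAlgebra ℂ L]
    {p : UniversalEnvelopingAlgebra ℂ L → Prop}
    (algebraMap : ∀ t, p (algebraMap ℂ _ t))
    (ι : ∀ x, p (UniversalEnvelopingAlgebra.ι ℂ x))
    (mul : ∀ u u', p u → p u' → p (u * u')) (add : ∀ u u', p u → p u' → p (u + u'))
    (u : UniversalEnvelopingAlgebra ℂ L) : p u := by
  let S : Subalgebra ℂ (UniversalEnvelopingAlgebra ℂ L) :=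
    { carrier := {u | p u}
      mul_mem' := fun h h' => mul _ _ h h'
      add_mem' := fun h h' => add _ _ h h'
      algebraMap_mem' := algebraMap }
  let f : L →ₗ⁅ℂ⁆ S :=
    { toFun := fun x => ⟨UniversalEnvelopingAlgebra.ι ℂ x, ι x⟩
      map_add' := fun x y => Subtype.ext (map_add _ x y)
      map_smul' := fun t x => Subtype.ext (map_smul _ t x)
      map_lie' := fun {x y} => Subtype.ext (LieHom.map_lie (UniversalEnvelopingAlgebra.ι ℂ) x y) }
  -- The lift into `S` followed by the inclusion is the identity, so every element lies in `S`.
  have h : S.val.comp (UniversalEnvelopingAlgebra.lift ℂ f) = AlgHom.id ℂ _ := by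
    apply UniversalEnvelopingAlgebra.hom_ext
    ext x
    change ((UniversalEnvelopingAlgebra.lift ℂ f (UniversalEnvelopingAlgebra.ι ℂ x) : S) :
      UniversalEnvelopingAlgebra ℂ L) = _
    rw [UniversalEnvelopingAlgebra.lift_ι_apply]
    rfl
  rw [show u = S.val (UniversalEnvelopingAlgebra.lift ℂ f u) from (DFunLike.congr_fun h u).symm]
  exact (UniversalEnvelopingAlgebra.lift ℂ f u).2

section HighestWeight

variable {M : Type*} [AddCommGroup M] [Module ℂ M] [LieRingModule ECGA M] [LieModule ℂ ECGA M]

theorem lie_mem_of_adapted {N : Submodule ℂ M} {w : M} (h : ∀ x ∈ adapted, ⁅x, w⁆ ∈ N)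
    (x : ECGA) : ⁅x, w⁆ ∈ N := by
  have hx : x ∈ Submodule.span ℂ adapted := span_adapted ▸ Submodule.mem_top
  induction hx using Submodule.span_induction with
  | mem x hx => exact h x hx
  | zero => rw [zero_lie]; exact N.zero_mem
  | add x y _ _ hx hy => rw [add_lie]; exact N.add_mem hx hy
  | smul t x _ hx => rw [smul_lie]; exact N.smul_mem t hx

theorem minusAction_ι (y : gMinus) (w : M) :
    minusAction M (UniversalEnvelopingAlgebra.ι ℂ y) w = ⁅(y : ECGA), w⁆ := by
  rw [minusAction, UniversalEnvelopingAlgebra.lift_ι_apply]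
  rfl

theorem minusAction_mem {N : Submodule ℂ M} (h : ∀ y ∈ gMinus, ∀ w ∈ N, ⁅y, w⁆ ∈ N)
    (u : UniversalEnvelopingAlgebra ℂ gMinus) {w : M} (hw : w ∈ N) :
    minusAction M u w ∈ N := by
  induction u using envelopingAlgebra_induction generalizing w with
  | algebraMap t => rw [AlgHom.commutes]; exact N.smul_mem t hw
  | ι y => rw [minusAction_ι]; exact h y y.2 w hw
  | mul u u' hu hu' => rw [map_mul]; exact hu (hu' hw)
  | add u u' hu hu' => rw [map_add]; exact N.add_mem (hu hw) (hu' hw)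

variable {d r θ : ℂ} {v : M}

/-- The submodule generated by a highest weight vector is its orbit under the enveloping algebra
of the lower triangular part. -/
theorem IsHighestWeightVector.coe_lieSpan (hv : IsHighestWeightVector d r θ v) :
    (LieSubmodule.lieSpan ℂ ECGA {v} : Set M) = Set.range fun u => minusAction M u v := by
  let N : Submodule ℂ M := LinearMap.range ((minusAction M).toLinearMap.flip v)
  have hN : ∀ y ∈ gMinus, ∀ w ∈ N, ⁅y, w⁆ ∈ N := by
    rintro y hy _ ⟨u, rfl⟩
    refine ⟨UniversalEnvelopingAlgebra.ι ℂ ⟨y, hy⟩ * u, ?_⟩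
    change minusAction M (_ * u) v = ⁅y, minusAction M u v⁆
    rw [map_mul, Module.End.mul_apply, minusAction_ι]
  have hvN : v ∈ N := ⟨1, by
    change minusAction M 1 v = v
    rw [map_one, Module.End.one_apply]⟩
  have hmem : ∀ {y}, y ∈ ({gC, Fplus, Fminus, Kminus} : Set ECGA) → y ∈ gMinus :=
    fun {y} hy => Submodule.subset_span hy
  have hvx : ∀ x : ECGA, ⁅x, v⁆ ∈ N := by
    apply lie_mem_of_adapted
    intro x hx
    simp only [adapted, Set.mem_insert_iff, Set.mem_singleton_iff] at hx
    rcases hx with rfl | rfl | rfl | rfl | rfl | rfl | rfl | rfl | rfl | rfl | rfl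
    · rw [hv.lie_D]; exact N.smul_mem _ hvN
    · rw [hv.lie_H]; exact N.zero_mem
    · exact hN _ (hmem (by simp)) v hvN
    · rw [hv.lie_J]; exact N.smul_mem _ hvN
    · rw [hv.lie_Theta]; exact N.smul_mem _ hvN
    · rw [hv.lie_Pplus]; exact N.zero_mem
    · rw [hv.lie_Pminus]; exact N.zero_mem
    · rw [hv.lie_Kplus]; exact N.zero_mem
    · exact hN _ (hmem (by simp)) v hvN
    · exact hN _ (hmem (by simp)) v hvN
    · exact hN _ (hmem (by simp)) v hvN
  -- This replaces the Poincaré–Birkhoff–Witt factorisation. Quantifying over all `w` lets the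
  -- product case compose, and quantifying over all `x` covers the bracket of `x` with `y` when `y`
  -- is moved to the left.
  have hNx : ∀ u : UniversalEnvelopingAlgebra ℂ gMinus, ∀ w, w ∈ N → (∀ x : ECGA, ⁅x, w⁆ ∈ N) →
      ∀ x : ECGA, ⁅x, minusAction M u w⁆ ∈ N := by
    intro u
    induction u using envelopingAlgebra_induction with
    | algebraMap t =>
      intro w hw h x
      rw [AlgHom.commutes]
      change ⁅x, t • w⁆ ∈ N
      rw [lie_smul]
      exact N.smul_mem t (h x)
    | ι y =>
      intro w hw h x
      rw [minusAction_ι, leibniz_lie]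
      exact N.add_mem (h _) (hN _ y.2 _ (h x))
    | mul u u' hu hu' =>
      intro w hw h x
      rw [map_mul]
      exact hu _ (minusAction_mem hN u' hw) (hu' w hw h) x
    | add u u' hu hu' =>
      intro w hw h x
      rw [map_add, LinearMap.add_apply, lie_add]
      exact N.add_mem (hu w hw h x) (hu' w hw h x)
  let N' : LieSubmodule ℂ ECGA M :=
    { N with lie_mem := by rintro x _ ⟨u, rfl⟩; exact hNx u v hvN hvx x }
  apply Set.Subset.antisymm
  · intro w hw
    have h : LieSubmodule.lieSpan ℂ ECGA {v} ≤ N' :=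
      LieSubmodule.lieSpan_le.2 (Set.singleton_subset_iff.2 hvN)
    exact h hw
  · rintro _ ⟨u, rfl⟩
    exact minusAction_mem (N := (LieSubmodule.lieSpan ℂ ECGA {v}).toSubmodule)
      (fun y _ w hw => LieSubmodule.lie_mem _ hw) u
      (LieSubmodule.subset_lieSpan (Set.mem_singleton v))

theorem IsHighestWeightVector.lieSpan_le (hv : IsHighestWeightVector d r θ v)
    {N : Submodule ℂ M} (hvN : v ∈ N) (hC : ∀ w ∈ N, ⁅gC, w⁆ ∈ N) (hFp : ∀ w ∈ N, ⁅Fplus, w⁆ ∈ N)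
    (hFm : ∀ w ∈ N, ⁅Fminus, w⁆ ∈ N) (hK : ∀ w ∈ N, ⁅Kminus, w⁆ ∈ N) :
    (LieSubmodule.lieSpan ℂ ECGA {v}).toSubmodule ≤ N := by
  intro w hw
  have hw' : w ∈ (LieSubmodule.lieSpan ℂ ECGA {v} : Set M) := hw
  rw [hv.coe_lieSpan] at hw'
  obtain ⟨u, rfl⟩ := hw'
  refine minusAction_mem ?_ u hvN
  intro y hy w hw
  have hy' : y ∈ Submodule.span ℂ ({gC, Fplus, Fminus, Kminus} : Set ECGA) := hy
  clear hy
  induction hy' using Submodule.span_induction with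
  | mem y hy =>
    simp only [Set.mem_insert_iff, Set.mem_singleton_iff] at hy
    rcases hy with rfl | rfl | rfl | rfl
    exacts [hC w hw, hFp w hw, hFm w hw, hK w hw]
  | zero => rw [zero_lie]; exact N.zero_mem
  | add x y hx hy ihx ihy => rw [add_lie]; exact N.add_mem ihx ihy
  | smul t x hx ih => rw [smul_lie]; exact N.smul_mem t ih

end HighestWeight

/-! ### The Verma module and its universal property -/

namespace Verma

variable {d r θ : ℂ}

theorem toU_smul (x : ECGA) (v : Verma d r θ) : toU x • v = ⁅x, v⁆ := rfl

theorem smul_ket (u : U) : u • ket d r θ = Submodule.Quotient.mk u := by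
  change Submodule.Quotient.mk (u • (1 : U)) = _
  rw [smul_eq_mul, mul_one]

theorem exists_smul_ket (v : Verma d r θ) : ∃ u : U, u • ket d r θ = v := by
  obtain ⟨u, rfl⟩ := Submodule.Quotient.mk_surjective _ v
  exact ⟨u, smul_ket u⟩

theorem smul_ket_eq_zero {u : U} (hu : u ∈ vermaIdeal d r θ) : u • ket d r θ = 0 := by
  rw [smul_ket]
  exact (Submodule.Quotient.mk_eq_zero _).2 hu

theorem lie_ket_eq_zero {x : ECGA} (hx : x ∈ ({gH, Pplus, Pminus, Kplus} : Set ECGA)) :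
    ⁅x, ket d r θ⁆ = 0 := by
  simp only [Set.mem_insert_iff, Set.mem_singleton_iff] at hx
  refine smul_ket_eq_zero (Submodule.subset_span ?_)
  rcases hx with rfl | rfl | rfl | rfl <;> simp

theorem lie_ket_eq_smul {x : ECGA} {t : ℂ} (h : toU x - algebraMap ℂ U t ∈ vermaIdeal d r θ) :
    ⁅x, ket d r θ⁆ = t • ket d r θ := by
  have := smul_ket_eq_zero h
  rwa [sub_smul, sub_eq_zero, algebraMap_smul] at this

theorem isHighestWeightVector_ket (h : ket d r θ ≠ 0) :
    IsHighestWeightVector d r θ (ket d r θ) where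
  ne_zero := h
  lie_D := lie_ket_eq_smul (Submodule.subset_span (by simp))
  lie_J := lie_ket_eq_smul (Submodule.subset_span (by simp))
  lie_Theta := lie_ket_eq_smul (Submodule.subset_span (by simp))
  lie_H := lie_ket_eq_zero (by simp)
  lie_Pplus := lie_ket_eq_zero (by simp)
  lie_Pminus := lie_ket_eq_zero (by simp)
  lie_Kplus := lie_ket_eq_zero (by simp)

theorem smul_mem (N : LieSubmodule ℂ ECGA (Verma d r θ)) (u : U) {v : Verma d r θ} (hv : v ∈ N) :
    u • v ∈ N := by
  induction u using envelopingAlgebra_induction generalizing v with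
  | algebraMap t => rw [algebraMap_smul]; exact N.smul_mem t hv
  | ι x => exact N.lie_mem hv
  | mul u u' hu hu' => rw [mul_smul]; exact hu (hu' hv)
  | add u u' hu hu' => rw [add_smul]; exact N.add_mem (hu hv) (hu' hv)

theorem eq_top_of_ket_mem {N : LieSubmodule ℂ ECGA (Verma d r θ)} (h : ket d r θ ∈ N) :
    N = ⊤ := by
  rw [eq_top_iff]
  rintro v -
  obtain ⟨u, rfl⟩ := exists_smul_ket v
  exact smul_mem N u h

theorem lieSpan_ket : LieSubmodule.lieSpan ℂ ECGA {ket d r θ} = ⊤ :=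
  eq_top_of_ket_mem (LieSubmodule.subset_lieSpan (Set.mem_singleton _))

/-- A linear map on the enveloping algebra that vanishes on `vermaIdeal` descends to the
Verma module. -/
def desc {W : Type*} [AddCommGroup W] [Module ℂ W] (g : U →ₗ[ℂ] W)
    (hg : ∀ u ∈ vermaIdeal d r θ, g u = 0) : Verma d r θ →ₗ[ℂ] W :=
  ((vermaIdeal d r θ).restrictScalars ℂ).liftQ g hg ∘ₗ
    (Submodule.Quotient.restrictScalarsEquiv ℂ (vermaIdeal d r θ)).symm.toLinearMap

theorem desc_smul_ket {W : Type*} [AddCommGroup W] [Module ℂ W] (g : U →ₗ[ℂ] W)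
    (hg : ∀ u ∈ vermaIdeal d r θ, g u = 0) (u : U) : desc g hg (u • ket d r θ) = g u := by
  rw [smul_ket]
  rfl

/-- The elements of `vermaIdeal` send `w` into a stable subspace `Z` if the generators do. -/
theorem mem_of_mem_vermaIdeal {W : Type*} [AddCommGroup W] [Module ℂ W]
    (ρ : U →ₐ[ℂ] Module.End ℂ W) (w : W) (Z : Submodule ℂ W)
    (hZ : ∀ x : ECGA, ∀ z ∈ Z, ρ (toU x) z ∈ Z)
    (h0 : ∀ x ∈ ({gH, Pplus, Pminus, Kplus} : Set ECGA), ρ (toU x) w ∈ Z)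
    (hD : ρ (toU gD) w - d • w ∈ Z) (hJ : ρ (toU gJ) w - r • w ∈ Z)
    (hT : ρ (toU gTheta) w - θ • w ∈ Z) {u : U} (hu : u ∈ vermaIdeal d r θ) : ρ u w ∈ Z := by
  have hZ' : ∀ u : U, ∀ z ∈ Z, ρ u z ∈ Z := by
    intro u
    induction u using envelopingAlgebra_induction with
    | algebraMap t => intro z hz; rw [AlgHom.commutes]; exact Z.smul_mem t hz
    | ι x => exact hZ x
    | mul u u' hu hu' => intro z hz; rw [map_mul]; exact hu _ (hu' z hz)
    | add u u' hu hu' => intro z hz; rw [map_add]; exact Z.add_mem (hu z hz) (hu' z hz)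
  have hsub : ∀ (x : ECGA) (t : ℂ), ρ (toU x) w - t • w ∈ Z →
      ρ (toU x - algebraMap ℂ U t) w ∈ Z := by
    intro x t h
    rwa [map_sub, AlgHom.commutes]
  induction hu using Submodule.span_induction with
  | mem u hu =>
    simp only [Set.mem_insert_iff, Set.mem_singleton_iff] at hu
    rcases hu with rfl | rfl | rfl | rfl | rfl | rfl | rfl
    · exact h0 _ (by simp)
    · exact h0 _ (by simp)
    · exact h0 _ (by simp)
    · exact h0 _ (by simp)
    · exact hsub _ _ hD
    · exact hsub _ _ hJ
    · exact hsub _ _ hT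
  | zero => rw [map_zero]; exact Z.zero_mem
  | add u u' _ _ hu hu' => rw [map_add]; exact Z.add_mem hu hu'
  | smul a u _ hu => rw [smul_eq_mul, map_mul]; exact hZ' a _ hu

/-- The universal property of the Verma module. -/
theorem exists_hom {M : Type*} [AddCommGroup M] [Module ℂ M] [LieRingModule ECGA M]
    [LieModule ℂ ECGA M] {v : M} (hv : IsHighestWeightVector d r θ v) :
    ∃ f : Verma d r θ →ₗ⁅ℂ,ECGA⁆ M, f (ket d r θ) = v := by
  let ρ : U →ₐ[ℂ] Module.End ℂ M := UniversalEnvelopingAlgebra.lift ℂ (LieModule.toEnd ℂ ECGA M)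
  have hρ : ∀ (x : ECGA) (m : M), ρ (toU x) m = ⁅x, m⁆ := by
    intro x m
    simp only [ρ, UniversalEnvelopingAlgebra.lift_ι_apply, LieModule.toEnd_apply_apply]
  have hker : ∀ u ∈ vermaIdeal d r θ, ρ.toLinearMap.flip v u = 0 := by
    intro u hu
    refine (Submodule.mem_bot ℂ).1 (mem_of_mem_vermaIdeal ρ v ⊥ ?_ ?_ ?_ ?_ ?_ hu)
    · rintro x z hz
      rw [(Submodule.mem_bot ℂ).1 hz, map_zero]
      exact Submodule.zero_mem _
    · intro x hx
      simp only [Set.mem_insert_iff, Set.mem_singleton_iff] at hx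
      rw [hρ, Submodule.mem_bot]
      rcases hx with rfl | rfl | rfl | rfl
      exacts [hv.lie_H, hv.lie_Pplus, hv.lie_Pminus, hv.lie_Kplus]
    · rw [hρ, hv.lie_D, sub_self]; exact Submodule.zero_mem _
    · rw [hρ, hv.lie_J, sub_self]; exact Submodule.zero_mem _
    · rw [hρ, hv.lie_Theta, sub_self]; exact Submodule.zero_mem _
  refine ⟨{ desc (ρ.toLinearMap.flip v) hker with map_lie' := ?_ }, ?_⟩
  · intro x m
    obtain ⟨u, rfl⟩ := exists_smul_ket m
    change desc (ρ.toLinearMap.flip v) hker (toU x • u • ket d r θ) =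
      ⁅x, desc (ρ.toLinearMap.flip v) hker (u • ket d r θ)⁆
    rw [← mul_smul, desc_smul_ket, desc_smul_ket]
    change ρ (toU x * u) v = ⁅x, ρ u v⁆
    rw [map_mul, Module.End.mul_apply, hρ]
  · change desc (ρ.toLinearMap.flip v) hker (ket d r θ) = v
    rw [← one_smul U (ket d r θ), desc_smul_ket]
    change ρ 1 v = v
    rw [map_one, Module.End.one_apply]

end Verma

/-! ### The coefficient map on the Verma module -/

/-- The coefficient family of the vacuum. -/
def vacuum : Coeff := fun a b c n => if a = 0 ∧ b = 0 ∧ c = 0 ∧ n = 0 then 1 else 0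

/-- Restriction of a coefficient family to non-negative exponents. -/
def restrictNat : Coeff →ₗ[ℂ] (ℕ → ℕ → ℕ → ℕ → ℂ) where
  toFun f a b c n := f a b c n
  map_add' _ _ := rfl
  map_smul' _ _ := rfl

theorem restrictNat_apply (f : Coeff) (a b c n : ℕ) : restrictNat f a b c n = f a b c n := rfl

/-- The counterpart of `modelFun` on families indexed by natural numbers. -/
def natModelFun (d r θ : ℂ) (x : ECGA) (f : ℕ → ℕ → ℕ → ℕ → ℂ) (a b c n : ℕ) : ℂ :=
  x D * ((d - a - b - n) * f a b c n)
  + x H * ((n - 2 * d - 2) * f a b c (n + 1) + 4 * θ * f a (b + 1) (c + 1) n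
      - 2 * c * f (a + 1) b (c - 1) n)
  + x C * (n * f a b c (n - 1) + b * c / (2 * θ) * f a (b - 1) (c - 1) n
      + a * f (a - 1) b (c + 1) n)
  + -Complex.I * x J * ((r - a + b - c) * f a b c n)
  + -Complex.I * x Th * (θ * f a b c n)
  + (x P1 - Complex.I * x P2) / 2 * (4 * θ * f (a + 1) b c n)
  + (x P1 + Complex.I * x P2) / 2 * (-4 * θ * f a (b + 1) c n)
  + (x K1 - Complex.I * x K2) / 2 * (-2 * θ * f a b (c + 1) n)
  + (x K1 + Complex.I * x K2) / 2 * (c * f a b (c - 1) n)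
  + (x F1 - Complex.I * x F2) / 2 * (b * f a (b - 1) c n)
  + (x F1 + Complex.I * x F2) / 2 * (a * f (a - 1) b c n)

/-- Every downward shift carries its exponent as a factor, and this factor vanishes just where
truncated and integer subtraction differ. -/
theorem natCast_mul_pred (k : ℕ) (g : ℤ → ℂ) :
    (k : ℂ) * g ((k : ℤ) - 1) = k * g ((k - 1 : ℕ) : ℤ) := by
  cases k <;> simp

/-- The values at non-negative exponents never feel the others; hence the kernel of `restrictNat` is
stable and the representation descends to the restrictions. -/
theorem restrictNat_modelFun (d r θ : ℂ) (x : ECGA) (f : Coeff) :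
    restrictNat (modelFun d r θ x f) = natModelFun d r θ x (restrictNat f) := by
  funext a b c n
  have ha (b c n : ℤ) := natCast_mul_pred a fun k => f k b c n
  have hb (a c n : ℤ) := natCast_mul_pred b fun k => f a k c n
  have hc (a b n : ℤ) := natCast_mul_pred c fun k => f a b k n
  have hn (a b c : ℤ) := natCast_mul_pred n fun k => f a b c k
  simp only [restrictNat_apply, natModelFun, modelFun, Nat.cast_add, Nat.cast_one, Int.cast_natCast]
  linear_combination (x F1 + Complex.I * x F2) / 2 * ha b c n + x C * ha b (c + 1) n
    + (x F1 - Complex.I * x F2) / 2 * hb a c n + (x K1 + Complex.I * x K2) / 2 * hc a b n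
    - 2 * x H * hc (a + 1) b n + x C * hn a b c
    + x C / (2 * θ) * c * hb a (c - 1) n + x C / (2 * θ) * b * hc a ((b - 1 : ℕ) : ℤ) n

theorem natModelFun_zero (d r θ : ℂ) (x : ECGA) : natModelFun d r θ x 0 = 0 := by
  funext a b c n
  simp [natModelFun]

namespace Verma

variable {d r θ : ℂ}

/-- The action of the enveloping algebra on coefficient families. -/
def modelAlgHom (d r : ℂ) {θ : ℂ} (hθ : θ ≠ 0) : U →ₐ[ℂ] Module.End ℂ Coeff :=
  UniversalEnvelopingAlgebra.lift ℂ (modelRep d r hθ)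

theorem modelAlgHom_toU (hθ : θ ≠ 0) (x : ECGA) (f : Coeff) :
    modelAlgHom d r hθ (toU x) f = modelFun d r θ x f := by
  rw [modelAlgHom, toU, UniversalEnvelopingAlgebra.lift_ι_apply]
  rfl

/-- The vacuum is a highest weight vector only modulo families that vanish at non-negative
exponents: P₊, for instance, moves it to a = −1. -/
theorem restrictNat_modelAlgHom_vacuum (hθ : θ ≠ 0) {u : U} (hu : u ∈ vermaIdeal d r θ) :
    restrictNat (modelAlgHom d r hθ u vacuum) = 0 := by
  have key : ∀ (x : ECGA) (t : ℂ), natModelFun d r θ x (restrictNat vacuum) =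
      t • restrictNat vacuum →
      modelAlgHom d r hθ (toU x) vacuum - t • vacuum ∈ LinearMap.ker restrictNat := by
    intro x t h
    rw [LinearMap.mem_ker, map_sub, map_smul, modelAlgHom_toU, restrictNat_modelFun, h, sub_self]
  have key0 : ∀ x : ECGA, natModelFun d r θ x (restrictNat vacuum) = 0 →
      modelAlgHom d r hθ (toU x) vacuum ∈ LinearMap.ker restrictNat := by
    intro x h
    rw [LinearMap.mem_ker, modelAlgHom_toU, restrictNat_modelFun, h]
  refine LinearMap.mem_ker.1 (mem_of_mem_vermaIdeal (modelAlgHom d r hθ) vacuum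
    (LinearMap.ker restrictNat) ?_ ?_ ?_ ?_ ?_ hu)
  · intro x z hz
    rw [LinearMap.mem_ker] at hz ⊢
    rw [modelAlgHom_toU, restrictNat_modelFun, hz, natModelFun_zero]
  · intro x hx
    apply key0
    funext a b c n
    simp only [Set.mem_insert_iff, Set.mem_singleton_iff] at hx
    rcases hx with rfl | rfl | rfl | rfl <;>
      simp [natModelFun, restrictNat_apply, vacuum, gH, Pplus, Pminus, Kplus, gen,
        add_apply, sub_apply, smul_apply, Nat.cast_add_one_ne_zero]
  · apply key
    funext a b c n
    by_cases h : a = 0 ∧ b = 0 ∧ c = 0 ∧ n = 0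
    · obtain ⟨rfl, rfl, rfl, rfl⟩ := h
      simp [natModelFun, restrictNat_apply, vacuum, gD, gen]
    · simp [natModelFun, restrictNat_apply, vacuum, gD, gen, h]
  · apply key
    funext a b c n
    by_cases h : a = 0 ∧ b = 0 ∧ c = 0 ∧ n = 0
    · obtain ⟨rfl, rfl, rfl, rfl⟩ := h
      simp [natModelFun, restrictNat_apply, vacuum, gJ, smul_apply, gen]
    · simp [natModelFun, restrictNat_apply, vacuum, gJ, smul_apply, gen, h]
  · apply key
    funext a b c n
    by_cases h : a = 0 ∧ b = 0 ∧ c = 0 ∧ n = 0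
    · obtain ⟨rfl, rfl, rfl, rfl⟩ := h
      simp [natModelFun, restrictNat_apply, vacuum, gTheta, smul_apply, gen]
    · simp [natModelFun, restrictNat_apply, vacuum, gTheta, smul_apply, gen, h]

/-- The coefficients of a vector of the Verma module in the (rescaled) basis of monomials in
`F₋`, `F₊`, `K₋` and the copy of `C` that commutes with them. -/
def coeff (d r : ℂ) {θ : ℂ} (hθ : θ ≠ 0) : Verma d r θ →ₗ[ℂ] (ℕ → ℕ → ℕ → ℕ → ℂ) :=
  desc (restrictNat ∘ₗ (modelAlgHom d r hθ).toLinearMap.flip vacuum)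
    fun _ hu => restrictNat_modelAlgHom_vacuum hθ hu

theorem coeff_smul_ket (hθ : θ ≠ 0) (u : U) :
    coeff d r hθ (u • ket d r θ) = restrictNat (modelAlgHom d r hθ u vacuum) :=
  desc_smul_ket _ _ u

theorem coeff_ket (hθ : θ ≠ 0) : coeff d r hθ (ket d r θ) = restrictNat vacuum := by
  rw [← one_smul U (ket d r θ), coeff_smul_ket, map_one, Module.End.one_apply]

theorem coeff_lie (hθ : θ ≠ 0) (x : ECGA) (v : Verma d r θ) :
    coeff d r hθ ⁅x, v⁆ = natModelFun d r θ x (coeff d r hθ v) := by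
  obtain ⟨u, rfl⟩ := exists_smul_ket v
  rw [← toU_smul, ← mul_smul, coeff_smul_ket, coeff_smul_ket, map_mul, Module.End.mul_apply,
    modelAlgHom_toU, restrictNat_modelFun]

section
variable (hθ : θ ≠ 0) (v : Verma d r θ) (a b c n : ℕ)

theorem coeff_D : coeff d r hθ ⁅gD, v⁆ a b c n = (d - a - b - n) * coeff d r hθ v a b c n := by
  rw [coeff_lie]
  simp [natModelFun, gD, gen]

theorem coeff_J :
    coeff d r hθ ⁅gJ, v⁆ a b c n = (r - a + b - c) * coeff d r hθ v a b c n := by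
  rw [coeff_lie]
  simp [natModelFun, gJ, gen, smul_apply]

theorem coeff_Pplus : coeff d r hθ ⁅Pplus, v⁆ a b c n = 4 * θ * coeff d r hθ v (a + 1) b c n := by
  rw [coeff_lie]
  simp [natModelFun, Pplus, gen, add_apply, smul_apply]

theorem coeff_Pminus :
    coeff d r hθ ⁅Pminus, v⁆ a b c n = -4 * θ * coeff d r hθ v a (b + 1) c n := by
  rw [coeff_lie]
  simp [natModelFun, Pminus, gen, sub_apply, smul_apply]

theorem coeff_Kplus : coeff d r hθ ⁅Kplus, v⁆ a b c n = -2 * θ * coeff d r hθ v a b (c + 1) n := by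
  rw [coeff_lie]
  simp [natModelFun, Kplus, gen, add_apply, smul_apply]

theorem coeff_Kminus : coeff d r hθ ⁅Kminus, v⁆ a b c n = c * coeff d r hθ v a b (c - 1) n := by
  rw [coeff_lie]
  simp [natModelFun, Kminus, gen, sub_apply, smul_apply]

theorem coeff_Fplus : coeff d r hθ ⁅Fplus, v⁆ a b c n = b * coeff d r hθ v a (b - 1) c n := by
  rw [coeff_lie]
  simp [natModelFun, Fplus, gen, add_apply, smul_apply]

theorem coeff_Fminus : coeff d r hθ ⁅Fminus, v⁆ a b c n = a * coeff d r hθ v (a - 1) b c n := by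
  rw [coeff_lie]
  simp [natModelFun, Fminus, gen, sub_apply, smul_apply]

theorem coeff_H : coeff d r hθ ⁅gH, v⁆ a b c n = (n - 2 * d - 2) * coeff d r hθ v a b c (n + 1)
    + 4 * θ * coeff d r hθ v a (b + 1) (c + 1) n
    - 2 * c * coeff d r hθ v (a + 1) b (c - 1) n := by
  rw [coeff_lie]
  simp [natModelFun, gH, gen]

theorem coeff_C : coeff d r hθ ⁅gC, v⁆ a b c n = n * coeff d r hθ v a b c (n - 1)
    + b * c / (2 * θ) * coeff d r hθ v a (b - 1) (c - 1) n
    + a * coeff d r hθ v (a - 1) b (c + 1) n := by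
  rw [coeff_lie]
  simp [natModelFun, gC, gen]

end

end Verma

/-! ### Commutation relations and the decoupled lowering operator -/

theorem lie_Fminus_Fplus : ⁅Fminus, Fplus⁆ = 0 := by
  ext g; cases g <;> simp only [lie_def, bracket, w] <;> simp [Fplus, Fminus, gen, add_apply,
    sub_apply, smul_apply, zero_apply]

theorem lie_Fminus_Kminus : ⁅Fminus, Kminus⁆ = 0 := by
  ext g; cases g <;> simp [lie_def, bracket, w, Kminus, Fminus, gen, sub_apply,
    smul_apply, zero_apply]

theorem lie_Fplus_Kminus : ⁅Fplus, Kminus⁆ = 0 := by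
  ext g; cases g <;> simp [lie_def, bracket, w, Kminus, Fplus, gen, add_apply, sub_apply,
    smul_apply, zero_apply]

theorem lie_Kplus_Fminus : ⁅Kplus, Fminus⁆ = 0 := by
  ext g; cases g <;> simp [lie_def, bracket, w, Kplus, Fminus, gen, add_apply, sub_apply,
    smul_apply, zero_apply]

theorem lie_Kplus_Fplus : ⁅Kplus, Fplus⁆ = 0 := by
  ext g; cases g <;> simp [lie_def, bracket, w, Kplus, Fplus, gen, add_apply,
    smul_apply, zero_apply]

theorem lie_C_Fminus : ⁅gC, Fminus⁆ = 0 := by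
  ext g; cases g <;> simp [lie_def, bracket, w, gC, Fminus, gen, sub_apply,
    smul_apply, zero_apply]

theorem lie_C_Fplus : ⁅gC, Fplus⁆ = 0 := by
  ext g; cases g <;> simp [lie_def, bracket, w, gC, Fplus, gen, add_apply,
    smul_apply, zero_apply]

theorem lie_C_Kminus : ⁅gC, Kminus⁆ = Fminus := by
  ext g; cases g <;> simp [lie_def, bracket, w, gC, Fminus, Kminus, gen, sub_apply,
    smul_apply]

theorem lie_C_Kplus : ⁅gC, Kplus⁆ = Fplus := by
  ext g; cases g <;> simp [lie_def, bracket, w, gC, Fplus, Kplus, gen, add_apply,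
    smul_apply]

theorem lie_Kplus_Kminus : ⁅Kplus, Kminus⁆ = (-2 : ℂ) • gTheta := by
  ext g; cases g <;> simp [lie_def, bracket, w, gTheta, Kplus, Kminus, gen, sub_apply,
    smul_apply]
  ring

theorem lie_Theta (x : ECGA) : ⁅gTheta, x⁆ = 0 := by
  ext g; cases g <;> simp [lie_def, bracket, w, gTheta, gen, smul_apply, zero_apply]

namespace Verma

variable {d r θ : ℂ}

/-- The action of an element of the algebra on the Verma module. -/
abbrev act (d r θ : ℂ) (x : ECGA) : Module.End ℂ (Verma d r θ) :=
  LieModule.toEnd ℂ ECGA (Verma d r θ) x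

theorem act_apply (x : ECGA) (v : Verma d r θ) : act d r θ x v = ⁅x, v⁆ := rfl

theorem act_lie (x y : ECGA) :
    act d r θ x * act d r θ y = act d r θ y * act d r θ x + act d r θ ⁅x, y⁆ := by
  ext v
  change ⁅x, ⁅y, v⁆⁆ = ⁅y, ⁅x, v⁆⁆ + ⁅⁅x, y⁆, v⁆
  rw [leibniz_lie, add_comm]

theorem act_zero : act d r θ 0 = 0 := map_zero _

theorem act_smul (t : ℂ) (x : ECGA) : act d r θ (t • x) = t • act d r θ x :=
  map_smul _ t x

theorem commute_act {x y : ECGA} (h : ⁅x, y⁆ = 0) : Commute (act d r θ x) (act d r θ y) := by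
  rw [commute_iff_eq, act_lie, h, act_zero, add_zero]

/-- Θ is central, so its θ-eigenspace is a submodule, and it contains the generator. -/
theorem act_Theta : act d r θ gTheta = θ • 1 := by
  let N : LieSubmodule ℂ ECGA (Verma d r θ) :=
    { LinearMap.ker (act d r θ gTheta - θ • 1) with
      lie_mem := by
        intro x v hv
        change v ∈ LinearMap.ker _ at hv
        change ⁅x, v⁆ ∈ LinearMap.ker _
        rw [LinearMap.mem_ker, LinearMap.sub_apply, sub_eq_zero, act_apply] at hv ⊢
        rw [leibniz_lie, lie_Theta, zero_lie, zero_add, hv]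
        exact lie_smul θ x v }
  have hN : N = ⊤ := by
    apply eq_top_of_ket_mem
    change _ ∈ LinearMap.ker _
    rw [LinearMap.mem_ker, LinearMap.sub_apply, sub_eq_zero, act_apply]
    exact lie_ket_eq_smul (Submodule.subset_span (by simp))
  ext v
  have hv : v ∈ N := hN ▸ LieSubmodule.mem_top v
  change v ∈ LinearMap.ker _ at hv
  rwa [LinearMap.mem_ker, LinearMap.sub_apply, sub_eq_zero] at hv

/-- The multiple of `C` plus a quadratic correction that commutes with `F±` and `K±`. -/
def lowering (d r θ : ℂ) : Module.End ℂ (Verma d r θ) :=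
  (2 * θ) • act d r θ gC - act d r θ Kminus * act d r θ Fplus + act d r θ Kplus * act d r θ Fminus

theorem lowering_apply (v : Verma d r θ) :
    lowering d r θ v = (2 * θ) • ⁅gC, v⁆ - ⁅Kminus, ⁅Fplus, v⁆⁆ + ⁅Kplus, ⁅Fminus, v⁆⁆ := rfl

theorem commute_lowering {y : ECGA} (hC : ⁅gC, y⁆ = 0) (hKm : ⁅Kminus, y⁆ = 0)
    (hFp : ⁅Fplus, y⁆ = 0) (hKp : ⁅Kplus, y⁆ = 0) (hFm : ⁅Fminus, y⁆ = 0) :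
    Commute (lowering d r θ) (act d r θ y) := by
  have h1 : Commute ((2 * θ) • act d r θ gC) (act d r θ y) := (commute_act hC).smul_left _
  have h2 : Commute (act d r θ Kminus * act d r θ Fplus) (act d r θ y) :=
    (commute_act hKm).mul_left (commute_act hFp)
  have h3 : Commute (act d r θ Kplus * act d r θ Fminus) (act d r θ y) :=
    (commute_act hKp).mul_left (commute_act hFm)
  exact (h1.sub_left h2).add_left h3

theorem commute_lowering_Fminus : Commute (lowering d r θ) (act d r θ Fminus) :=
  commute_lowering lie_C_Fminus (by rw [← lie_skew, lie_Fminus_Kminus, neg_zero])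
    (by rw [← lie_skew, lie_Fminus_Fplus, neg_zero]) lie_Kplus_Fminus (lie_self _)

theorem commute_lowering_Fplus : Commute (lowering d r θ) (act d r θ Fplus) :=
  commute_lowering lie_C_Fplus (by rw [← lie_skew, lie_Fplus_Kminus, neg_zero])
    (lie_self _) lie_Kplus_Fplus lie_Fminus_Fplus

theorem act_Kplus_mul_Kminus : act d r θ Kplus * act d r θ Kminus =
    act d r θ Kminus * act d r θ Kplus - (2 * θ) • 1 := by
  rw [act_lie, lie_Kplus_Kminus, act_smul, act_Theta, smul_smul, neg_mul, neg_smul, sub_eq_add_neg]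

/-- Commuting K₋ past 2θC produces 2θF₋, which [K₊, K₋]F₋ = −2θF₋ cancels. For K₊ the cancelling
term comes from −K₋F₊. -/
theorem commute_lowering_Kminus : Commute (lowering d r θ) (act d r θ Kminus) := by
  have h1 : act d r θ Fplus * act d r θ Kminus = act d r θ Kminus * act d r θ Fplus :=
    commute_act lie_Fplus_Kminus
  have h2 : act d r θ Fminus * act d r θ Kminus = act d r θ Kminus * act d r θ Fminus :=
    commute_act lie_Fminus_Kminus
  have h3 := act_lie (d := d) (r := r) (θ := θ) gC Kminus
  rw [lie_C_Kminus] at h3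
  rw [commute_iff_eq, lowering, add_mul, sub_mul, smul_mul_assoc, h3, mul_assoc, h1, mul_assoc, h2,
    ← mul_assoc (act d r θ Kplus), act_Kplus_mul_Kminus]
  simp only [mul_add, mul_sub, sub_mul, mul_smul_comm, smul_mul_assoc, one_mul, smul_add,
    mul_assoc]
  abel

theorem commute_lowering_Kplus : Commute (lowering d r θ) (act d r θ Kplus) := by
  have h1 : act d r θ Fplus * act d r θ Kplus = act d r θ Kplus * act d r θ Fplus :=
    (commute_act lie_Kplus_Fplus).symm
  have h2 : act d r θ Fminus * act d r θ Kplus = act d r θ Kplus * act d r θ Fminus :=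
    (commute_act lie_Kplus_Fminus).symm
  have h3 := act_lie (d := d) (r := r) (θ := θ) gC Kplus
  rw [lie_C_Kplus] at h3
  rw [commute_iff_eq, lowering, add_mul, sub_mul, smul_mul_assoc, h3, mul_assoc, h1, mul_assoc, h2,
    mul_add, mul_sub, mul_smul_comm, ← mul_assoc (act d r θ Kplus) (act d r θ Kminus),
    act_Kplus_mul_Kminus]
  simp only [sub_mul, smul_mul_assoc, one_mul, smul_add, mul_assoc]
  abel

theorem lie_Kplus_lowering_pow_ket (n : ℕ) : ⁅Kplus, (lowering d r θ ^ n) (ket d r θ)⁆ = 0 := by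
  have h := (commute_lowering_Kplus (d := d) (r := r) (θ := θ)).pow_left n
  have := LinearMap.congr_fun h.eq (ket d r θ)
  rw [Module.End.mul_apply, Module.End.mul_apply, act_apply, act_apply,
    lie_ket_eq_zero (by simp), map_zero] at this
  exact this.symm

/-- The correction K₊F₋ contributes nothing here: K₊ commutes with F₋ and with `lowering`, and kills
the highest weight vector. -/
theorem singularVector_eq (p : ℕ) :
    singularVector d r θ p = (lowering d r θ ^ p) (ket d r θ) := by
  rw [singularVector]
  induction p with
  | zero => rw [pow_zero, pow_zero, one_smul, Module.End.one_apply]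
  | succ p ih =>
    rw [pow_succ', mul_smul, ih, pow_succ', Module.End.mul_apply, lowering_apply]
    have h := LinearMap.congr_fun (commute_act (d := d) (r := r) (θ := θ) lie_Kplus_Fminus).eq
      ((lowering d r θ ^ p) (ket d r θ))
    rw [Module.End.mul_apply, Module.End.mul_apply, act_apply, act_apply, act_apply, act_apply,
      lie_Kplus_lowering_pow_ket, lie_zero] at h
    rw [h, add_zero, sub_smul, smul_assoc, mul_smul (toU Kminus)]
    rfl

/-! ### The monomial basis -/

/-- The monomial basis of the Verma module. -/
def monomial (d r θ : ℂ) (i : ℕ × ℕ × ℕ × ℕ) : Verma d r θ :=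
  (act d r θ Fminus ^ i.1) ((act d r θ Fplus ^ i.2.1) ((act d r θ Kminus ^ i.2.2.1)
    ((lowering d r θ ^ i.2.2.2) (ket d r θ))))

theorem pow_apply_comm {A B : Module.End ℂ (Verma d r θ)} (h : Commute A B) (n : ℕ)
    (v : Verma d r θ) : A ((B ^ n) v) = (B ^ n) (A v) := by
  rw [← Module.End.mul_apply, ← Module.End.mul_apply, (h.pow_right n).eq]

theorem Fminus_monomial (a b c n : ℕ) :
    ⁅Fminus, monomial d r θ (a, b, c, n)⁆ = monomial d r θ (a + 1, b, c, n) := by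
  rw [← act_apply, monomial, monomial, pow_succ', Module.End.mul_apply]

theorem Fplus_monomial (a b c n : ℕ) :
    ⁅Fplus, monomial d r θ (a, b, c, n)⁆ = monomial d r θ (a, b + 1, c, n) := by
  rw [← act_apply, monomial, monomial, pow_apply_comm (commute_act lie_Fminus_Fplus).symm,
    pow_succ', Module.End.mul_apply]

theorem Kminus_monomial (a b c n : ℕ) :
    ⁅Kminus, monomial d r θ (a, b, c, n)⁆ = monomial d r θ (a, b, c + 1, n) := by
  rw [← act_apply, monomial, monomial, pow_apply_comm (commute_act lie_Fminus_Kminus).symm,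
    pow_apply_comm (commute_act lie_Fplus_Kminus).symm, pow_succ', Module.End.mul_apply]

theorem lowering_monomial (a b c n : ℕ) :
    lowering d r θ (monomial d r θ (a, b, c, n)) = monomial d r θ (a, b, c, n + 1) := by
  rw [monomial, monomial, pow_apply_comm commute_lowering_Fminus,
    pow_apply_comm commute_lowering_Fplus, pow_apply_comm commute_lowering_Kminus, pow_succ',
    Module.End.mul_apply]

theorem Kplus_monomial (a b c n : ℕ) : ⁅Kplus, monomial d r θ (a, b, c, n)⁆ =
    (-2 * θ * c) • monomial d r θ (a, b, c - 1, n) := by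
  have h : ∀ c : ℕ, ⁅Kplus, (act d r θ Kminus ^ c) ((lowering d r θ ^ n) (ket d r θ))⁆ =
      (-2 * θ * c) • (act d r θ Kminus ^ (c - 1)) ((lowering d r θ ^ n) (ket d r θ)) := by
    intro c
    induction c with
    | zero => simp [lie_Kplus_lowering_pow_ket]
    | succ c ih =>
      rw [pow_succ', Module.End.mul_apply, ← act_apply, ← Module.End.mul_apply,
        act_Kplus_mul_Kminus, LinearMap.sub_apply, Module.End.mul_apply, act_apply Kplus, ih,
        map_smul]
      rcases c with _ | c
      · simp
      · rw [Nat.add_sub_cancel, Nat.add_sub_cancel, ← Module.End.mul_apply (act d r θ Kminus),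
          ← pow_succ', LinearMap.smul_apply, Module.End.one_apply, ← sub_smul]
        push_cast
        congr 1
        ring
  rw [← act_apply, monomial, monomial, pow_apply_comm (commute_act lie_Kplus_Fminus),
    pow_apply_comm (commute_act lie_Kplus_Fplus), act_apply Kplus, h, map_smul, map_smul]

theorem span_monomial (hket : ket d r θ ≠ 0) (hθ : θ ≠ 0) :
    Submodule.span ℂ (Set.range (monomial d r θ)) = ⊤ := by
  set N := Submodule.span ℂ (Set.range (monomial d r θ)) with hN
  have hmem : ∀ i, monomial d r θ i ∈ N := fun i => Submodule.subset_span ⟨i, rfl⟩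
  have stable : ∀ A : Module.End ℂ (Verma d r θ), (∀ a b c n, A (monomial d r θ (a, b, c, n)) ∈ N) →
      ∀ w ∈ N, A w ∈ N := by
    intro A hA w hw
    have : N ≤ N.comap A := by
      conv_lhs => rw [hN]
      rw [Submodule.span_le]
      rintro _ ⟨⟨a, b, c, n⟩, rfl⟩
      exact hA a b c n
    exact this hw
  have hFm := stable (act d r θ Fminus) fun a b c n => by
    rw [act_apply, Fminus_monomial]; exact hmem _
  have hFp := stable (act d r θ Fplus) fun a b c n => by
    rw [act_apply, Fplus_monomial]; exact hmem _
  have hKm := stable (act d r θ Kminus) fun a b c n => by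
    rw [act_apply, Kminus_monomial]; exact hmem _
  have hKp := stable (act d r θ Kplus) fun a b c n => by
    rw [act_apply, Kplus_monomial]; exact N.smul_mem _ (hmem _)
  have hl := stable (lowering d r θ) fun a b c n => by
    rw [lowering_monomial]; exact hmem _
  have hC : ∀ w ∈ N, ⁅gC, w⁆ ∈ N := by
    intro w hw
    -- C is recovered from `lowering` by dividing by 2θ; this is why stability under K₊ was needed
    -- although K₊ is not in 𝔤⁻.
    have h2θ : (2 * θ) ≠ 0 := mul_ne_zero two_ne_zero hθ
    rw [← N.smul_mem_iff h2θ]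
    have : (2 * θ) • ⁅gC, w⁆ =
        lowering d r θ w + ⁅Kminus, ⁅Fplus, w⁆⁆ - ⁅Kplus, ⁅Fminus, w⁆⁆ := by
      rw [lowering_apply]; abel
    rw [this]
    exact N.sub_mem (N.add_mem (hl w hw) (hKm _ (hFp w hw))) (hKp _ (hFm w hw))
  rw [eq_top_iff]
  have h := (isHighestWeightVector_ket hket).lieSpan_le (N := N) (hmem (0, 0, 0, 0)) hC hFp hFm hKm
  rwa [lieSpan_ket] at h

theorem coeff_lowering (hθ : θ ≠ 0) (v : Verma d r θ) (a b c n : ℕ) :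
    coeff d r hθ (lowering d r θ v) a b c n = 2 * θ * n * coeff d r hθ v a b c (n - 1) := by
  rw [lowering_apply, map_add, map_sub, map_smul]
  simp only [Pi.add_apply, Pi.sub_apply, Pi.smul_apply, smul_eq_mul, coeff_C, coeff_Kminus,
    coeff_Fplus, coeff_Kplus, coeff_Fminus]
  field_simp
  ring

/-- The vector `v` is a non-zero multiple of a monomial, as far as its coefficients tell. -/
def HasMonomialCoeff (hθ : θ ≠ 0) (v : Verma d r θ) (i : ℕ × ℕ × ℕ × ℕ) : Prop :=
  ∃ t : ℂ, t ≠ 0 ∧ ∀ a b c n, coeff d r hθ v a b c n = if (a, b, c, n) = i then t else 0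

/-- Each creation operator shifts one exponent and multiplies by it; the scalar built up is a! b! c!
n! (2θ)^n. -/
theorem hasMonomialCoeff_monomial (hθ : θ ≠ 0) (i : ℕ × ℕ × ℕ × ℕ) :
    HasMonomialCoeff hθ (monomial d r θ i) i := by
  obtain ⟨a, b, c, n⟩ := i
  induction a with
  | succ a ih =>
    obtain ⟨t, ht, h⟩ := ih
    refine ⟨(a + 1) * t, mul_ne_zero (Nat.cast_add_one_ne_zero a) ht, fun a' b' c' n' => ?_⟩
    rw [← Fminus_monomial, coeff_Fminus, h]
    rcases a' with _ | a' <;> simp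
    split_ifs with h <;> simp [h]
  | zero =>
  induction b with
  | succ b ih =>
    obtain ⟨t, ht, h⟩ := ih
    refine ⟨(b + 1) * t, mul_ne_zero (Nat.cast_add_one_ne_zero b) ht, fun a' b' c' n' => ?_⟩
    rw [← Fplus_monomial, coeff_Fplus, h]
    rcases b' with _ | b' <;> simp
    split_ifs with h <;> simp [h]
  | zero =>
  induction c with
  | succ c ih =>
    obtain ⟨t, ht, h⟩ := ih
    refine ⟨(c + 1) * t, mul_ne_zero (Nat.cast_add_one_ne_zero c) ht, fun a' b' c' n' => ?_⟩
    rw [← Kminus_monomial, coeff_Kminus, h]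
    rcases c' with _ | c' <;> simp
    split_ifs with h <;> simp [h]
  | zero =>
  induction n with
  | succ n ih =>
    obtain ⟨t, ht, h⟩ := ih
    refine ⟨2 * θ * (n + 1) * t, mul_ne_zero (mul_ne_zero (mul_ne_zero two_ne_zero hθ)
      (Nat.cast_add_one_ne_zero n)) ht, fun a' b' c' n' => ?_⟩
    rw [← lowering_monomial, coeff_lowering, h]
    rcases n' with _ | n' <;> simp
    split_ifs with h <;> simp [h]
  | zero =>
    refine ⟨1, one_ne_zero, fun a b c n => ?_⟩
    change coeff d r hθ (ket d r θ) a b c n = _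
    rw [coeff_ket]
    simp [restrictNat_apply, vacuum]

theorem ket_ne_zero (hθ : θ ≠ 0) : ket d r θ ≠ 0 := by
  intro h
  obtain ⟨t, ht, h'⟩ := hasMonomialCoeff_monomial (d := d) (r := r) hθ (0, 0, 0, 0)
  have := h' 0 0 0 0
  rw [if_pos rfl] at this
  apply ht
  rw [← this]
  change coeff d r hθ (ket d r θ) 0 0 0 0 = 0
  rw [h, map_zero]
  rfl

/-- A vector is a finite combination of exactly those monomials at which its coefficients do not
vanish. -/
theorem exists_finsupp (hθ : θ ≠ 0) (v : Verma d r θ) : ∃ l : (ℕ × ℕ × ℕ × ℕ) →₀ ℂ,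
    v = l.sum (fun i z => z • monomial d r θ i) ∧
      ∀ a b c n, coeff d r hθ v a b c n = 0 ↔ l (a, b, c, n) = 0 := by
  have hv : v ∈ Submodule.span ℂ (Set.range (monomial d r θ)) :=
    span_monomial (ket_ne_zero hθ) hθ ▸ Submodule.mem_top
  obtain ⟨l, hl⟩ := Finsupp.mem_span_range_iff_exists_finsupp.1 hv
  refine ⟨l, hl.symm, fun a b c n => ?_⟩
  obtain ⟨t, ht, h⟩ := hasMonomialCoeff_monomial (d := d) (r := r) hθ (a, b, c, n)
  have : coeff d r hθ v a b c n = l (a, b, c, n) * t := by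
    rw [← hl, Finsupp.sum, map_sum, Finset.sum_apply, Finset.sum_apply, Finset.sum_apply,
      Finset.sum_apply, Finset.sum_eq_single (a, b, c, n)]
    · rw [map_smul]
      simp [h]
    · intro j _ hj
      obtain ⟨s, -, hs⟩ := hasMonomialCoeff_monomial (d := d) (r := r) hθ j
      rw [map_smul]
      simp [hs, hj.symm]
    · intro hi
      simp [Finsupp.notMem_support_iff.1 hi]
  rw [this, mul_eq_zero, or_iff_left ht]

theorem mem_of_monomial_mem (hθ : θ ≠ 0) {N : Submodule ℂ (Verma d r θ)} {v : Verma d r θ}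
    (h : ∀ a b c n, coeff d r hθ v a b c n ≠ 0 → monomial d r θ (a, b, c, n) ∈ N) : v ∈ N := by
  obtain ⟨l, hl, hl'⟩ := exists_finsupp hθ v
  rw [hl]
  refine N.sum_mem fun i hi => N.smul_mem _ (h i.1 i.2.1 i.2.2.1 i.2.2.2 ?_)
  exact (hl' _ _ _ _).not.2 (Finsupp.mem_support_iff.1 hi)

theorem coeff_injective (hθ : θ ≠ 0) : Function.Injective (coeff d r hθ) := by
  rw [injective_iff_map_eq_zero]
  intro v hv
  have : v ∈ (⊥ : Submodule ℂ (Verma d r θ)) :=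
    mem_of_monomial_mem hθ fun a b c n h => absurd (by rw [hv]; rfl) h
  exact (Submodule.mem_bot ℂ).1 this

theorem finite_coeff_ne_zero (hθ : θ ≠ 0) (v : Verma d r θ) :
    {i : ℕ × ℕ × ℕ × ℕ | coeff d r hθ v i.1 i.2.1 i.2.2.1 i.2.2.2 ≠ 0}.Finite := by
  obtain ⟨l, -, hl⟩ := exists_finsupp hθ v
  refine l.support.finite_toSet.subset fun i hi => ?_
  exact Finsupp.mem_support_iff.2 ((hl _ _ _ _).not.1 hi)

/-! ### Singular degrees and the largest proper submodule -/

/-- The exponents of `lowering` that are at least the exponent of the singular vector; there are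
none if `2d + 3` is not a positive integer. -/
def IsSingularDegree (d : ℂ) (n : ℕ) : Prop := ∃ k < n, (k : ℂ) = 2 * d + 2

theorem not_isSingularDegree_zero : ¬ IsSingularDegree d 0 := by
  rintro ⟨k, hk, -⟩
  exact Nat.not_lt_zero k hk

theorem isSingularDegree_mono {m n : ℕ} (h : IsSingularDegree d m) (hmn : m ≤ n) :
    IsSingularDegree d n := by
  obtain ⟨k, hk, h⟩ := h
  exact ⟨k, hk.trans_le hmn, h⟩

theorem isSingularDegree_succ {n : ℕ} (h : IsSingularDegree d (n + 1)) :
    IsSingularDegree d n ∨ (n : ℂ) - 2 * d - 2 = 0 := by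
  obtain ⟨k, hk, h⟩ := h
  rcases Nat.lt_succ_iff_lt_or_eq.1 hk with hk | rfl
  · exact Or.inl ⟨k, hk, h⟩
  · right; rw [h]; ring

/-- The largest proper submodule of the Verma module. -/
def maxSubmodule (d r : ℂ) {θ : ℂ} (hθ : θ ≠ 0) : LieSubmodule ℂ ECGA (Verma d r θ) where
  carrier := {v | ∀ a b c n, ¬ IsSingularDegree d n → coeff d r hθ v a b c n = 0}
  add_mem' := by
    intro v v' hv hv' a b c n hn
    rw [map_add, Pi.add_apply, Pi.add_apply, Pi.add_apply, Pi.add_apply, hv a b c n hn,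
      hv' a b c n hn, add_zero]
  zero_mem' := by
    intro a b c n _
    rw [map_zero]; rfl
  smul_mem' := by
    intro t v hv a b c n hn
    rw [map_smul, Pi.smul_apply, Pi.smul_apply, Pi.smul_apply, Pi.smul_apply, hv a b c n hn,
      smul_zero]
  lie_mem := by
    intro x v hv a b c n hn
    have h : ∀ a b c, coeff d r hθ v a b c n = 0 := fun a b c => hv a b c n hn
    have hpred : coeff d r hθ v a b c (n - 1) = 0 :=
      hv a b c _ fun h => hn (isSingularDegree_mono h (Nat.sub_le n 1))
    -- Only H can lead out of the singular degrees, by reading degree n + 1. At the threshold n = 2d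
    -- + 2 its factor vanishes.
    have hsucc : ((n : ℂ) - 2 * d - 2) * coeff d r hθ v a b c (n + 1) = 0 := by
      by_cases hn' : IsSingularDegree d (n + 1)
      · rw [(isSingularDegree_succ hn').resolve_left hn, zero_mul]
      · rw [hv a b c _ hn', mul_zero]
    rw [coeff_lie, natModelFun]
    simp only [h, hpred, hsucc, mul_zero, add_zero, sub_zero]

theorem mem_maxSubmodule (hθ : θ ≠ 0) {v : Verma d r θ} : v ∈ maxSubmodule d r hθ ↔
    ∀ a b c n, ¬ IsSingularDegree d n → coeff d r hθ v a b c n = 0 := Iff.rfl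

theorem coeff_ket_zero (hθ : θ ≠ 0) : coeff d r hθ (ket d r θ) 0 0 0 0 = 1 := by
  rw [coeff_ket]
  simp [restrictNat_apply, vacuum]

theorem maxSubmodule_ne_top (hθ : θ ≠ 0) : maxSubmodule d r hθ ≠ ⊤ := by
  intro h
  have hket : ket d r θ ∈ maxSubmodule d r hθ := h ▸ LieSubmodule.mem_top _
  have := hket 0 0 0 0 not_isSingularDegree_zero
  rw [coeff_ket_zero] at this
  exact one_ne_zero this

/-! ### Reduction of a vector to the highest weight vector -/

section Reduction

variable (hθ : θ ≠ 0) {N : LieSubmodule ℂ ECGA (Verma d r θ)}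

theorem exists_shift_Fminus {v : Verma d r θ} (hv : v ∈ N) (k : ℕ) :
    ∃ w ∈ N, ∀ a b c n, coeff d r hθ w a b c n = coeff d r hθ v (a + k) b c n := by
  induction k with
  | zero => exact ⟨v, hv, fun _ _ _ _ => rfl⟩
  | succ k ih =>
    obtain ⟨w, hw, h⟩ := ih
    refine ⟨(4 * θ)⁻¹ • ⁅Pplus, w⁆, N.smul_mem _ (N.lie_mem hw), fun a b c n => ?_⟩
    rw [map_smul, Pi.smul_apply, Pi.smul_apply, Pi.smul_apply, Pi.smul_apply, coeff_Pplus, h,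
      smul_eq_mul, inv_mul_cancel_left₀ (mul_ne_zero (by norm_num : (4 : ℂ) ≠ 0) hθ),
      add_right_comm, add_assoc]

theorem exists_shift_Fplus {v : Verma d r θ} (hv : v ∈ N) (k : ℕ) :
    ∃ w ∈ N, ∀ a b c n, coeff d r hθ w a b c n = coeff d r hθ v a (b + k) c n := by
  induction k with
  | zero => exact ⟨v, hv, fun _ _ _ _ => rfl⟩
  | succ k ih =>
    obtain ⟨w, hw, h⟩ := ih
    refine ⟨(-4 * θ)⁻¹ • ⁅Pminus, w⁆, N.smul_mem _ (N.lie_mem hw), fun a b c n => ?_⟩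
    rw [map_smul, Pi.smul_apply, Pi.smul_apply, Pi.smul_apply, Pi.smul_apply, coeff_Pminus, h,
      smul_eq_mul, inv_mul_cancel_left₀ (mul_ne_zero (by norm_num : (-4 : ℂ) ≠ 0) hθ),
      add_right_comm, add_assoc]

theorem exists_shift_Kminus {v : Verma d r θ} (hv : v ∈ N) (k : ℕ) :
    ∃ w ∈ N, ∀ a b c n, coeff d r hθ w a b c n = coeff d r hθ v a b (c + k) n := by
  induction k with
  | zero => exact ⟨v, hv, fun _ _ _ _ => rfl⟩
  | succ k ih =>
    obtain ⟨w, hw, h⟩ := ih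
    refine ⟨(-2 * θ)⁻¹ • ⁅Kplus, w⁆, N.smul_mem _ (N.lie_mem hw), fun a b c n => ?_⟩
    rw [map_smul, Pi.smul_apply, Pi.smul_apply, Pi.smul_apply, Pi.smul_apply, coeff_Kplus, h,
      smul_eq_mul, inv_mul_cancel_left₀ (mul_ne_zero (by norm_num : (-2 : ℂ) ≠ 0) hθ),
      add_right_comm, add_assoc]

theorem exists_shift_lowering {v : Verma d r θ} (hv : v ∈ N) (m : ℕ) :
    ∃ w ∈ N, ∀ a b c n, coeff d r hθ w a b c n =
      (∏ k ∈ Finset.range m, (((n + k : ℕ) : ℂ) - 2 * d - 2)) * coeff d r hθ v a b c (n + m) := by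
  induction m with
  | zero => exact ⟨v, hv, fun _ _ _ _ => by simp⟩
  | succ m ih =>
    obtain ⟨w, hw, h⟩ := ih
    -- The quadratic terms cancel the parts of H that alter a, b, c; what remains is the sl₂ raising
    -- operator.
    refine ⟨(2 * θ)⁻¹ • ((2 * θ) • ⁅gH, w⁆ - ⁅Pminus, ⁅Kplus, w⁆⁆ + ⁅Pplus, ⁅Kminus, w⁆⁆),
      N.smul_mem _ (N.add_mem (N.sub_mem (N.smul_mem _ (N.lie_mem hw))
        (N.lie_mem (N.lie_mem hw))) (N.lie_mem (N.lie_mem hw))), fun a b c n => ?_⟩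
    have : ∀ k, n + 1 + k = n + (k + 1) := fun k => by omega
    have hprod : ∏ k ∈ Finset.range m, (((n + (k + 1) : ℕ) : ℂ) - 2 * d - 2) =
        ∏ k ∈ Finset.range m, (((n + 1 + k : ℕ) : ℂ) - 2 * d - 2) :=
      Finset.prod_congr rfl fun k _ => by rw [this]
    rw [Finset.prod_range_succ', add_zero, ← this m, hprod, mul_right_comm, ← h,
      map_smul, map_add, map_sub, map_smul]
    simp only [Pi.smul_apply, Pi.add_apply, Pi.sub_apply, smul_eq_mul, coeff_H, coeff_Pminus,
      coeff_Kplus, coeff_Pplus, coeff_Kminus]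
    field_simp
    ring

theorem exists_shift {v : Verma d r θ} (hv : v ∈ N) (i j k m : ℕ) :
    ∃ w ∈ N, ∀ a b c n, coeff d r hθ w a b c n =
      (∏ l ∈ Finset.range m, (((n + l : ℕ) : ℂ) - 2 * d - 2)) *
        coeff d r hθ v (a + i) (b + j) (c + k) (n + m) := by
  obtain ⟨v₁, hv₁, h₁⟩ := exists_shift_Fminus hθ hv i
  obtain ⟨v₂, hv₂, h₂⟩ := exists_shift_Fplus hθ hv₁ j
  obtain ⟨v₃, hv₃, h₃⟩ := exists_shift_Kminus hθ hv₂ k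
  obtain ⟨v₄, hv₄, h₄⟩ := exists_shift_lowering hθ hv₃ m
  exact ⟨v₄, hv₄, fun a b c n => by rw [h₄, h₃, h₂, h₁]⟩

/-- A submodule contains the highest weight vector if it contains a vector that has a component
along it and whose other components have a different `D`-weight. -/
theorem ket_mem_of_coeff_ne_zero {v : Verma d r θ} (hv : v ∈ N)
    (h0 : coeff d r hθ v 0 0 0 0 ≠ 0)
    (h : ∀ a b c n, coeff d r hθ v a b c n ≠ 0 → (a, b, c, n) ≠ (0, 0, 0, 0) → a + b + n ≠ 0) :
    ket d r θ ∈ N := by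
  obtain ⟨s, hs⟩ : ∃ s : Finset (ℕ × ℕ × ℕ × ℕ), ∀ a b c n, coeff d r hθ v a b c n ≠ 0 →
      (a, b, c, n) ≠ (0, 0, 0, 0) → (a, b, c, n) ∈ s :=
    ⟨(finite_coeff_ne_zero hθ v).toFinset, fun a b c n h _ => by simpa using h⟩
  induction s using Finset.induction_on generalizing v with
  | empty =>
    have : v = coeff d r hθ v 0 0 0 0 • ket d r θ := by
      apply coeff_injective hθ
      funext a b c n
      rw [map_smul, coeff_ket, Pi.smul_apply, Pi.smul_apply, Pi.smul_apply, Pi.smul_apply,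
        restrictNat_apply]
      by_cases hi : (a, b, c, n) = (0, 0, 0, 0)
      · simp only [Prod.mk.injEq] at hi
        obtain ⟨rfl, rfl, rfl, rfl⟩ := hi
        simp [vacuum]
      · have hz : coeff d r hθ v a b c n = 0 := by
          by_contra hne
          exact absurd (hs a b c n hne hi) (Finset.notMem_empty _)
        simp only [Prod.mk.injEq] at hi
        simp [vacuum, hz, hi]
    rw [this] at hv
    exact (N.smul_mem_iff h0).1 hv
  | insert i s _ ih =>
    obtain ⟨a₀, b₀, c₀, n₀⟩ := i
    by_cases hi : a₀ + b₀ + n₀ = 0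
    -- An index with the D-weight of the vacuum does not occur in `v`, by `h`, unless it is the
    -- vacuum itself, so it can be dropped.
    · refine ih hv h0 h fun a b c n hne hne' => ?_
      refine (Finset.mem_insert.1 (hs a b c n hne hne')).resolve_left fun heq => ?_
      simp only [Prod.mk.injEq] at heq
      have := h a b c n hne hne'
      omega
    -- D minus the weight of the index `i` removes that component and multiplies the vacuum
    -- component by a₀ + b₀ + n₀ ≠ 0.
    have hco : ∀ a b c n, coeff d r hθ (⁅gD, v⁆ - (d - a₀ - b₀ - n₀) • v) a b c n =
        (((a₀ + b₀ + n₀ : ℕ) : ℂ) - ((a + b + n : ℕ) : ℂ)) * coeff d r hθ v a b c n := by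
      intro a b c n
      rw [map_sub, map_smul]
      simp only [Pi.smul_apply, Pi.sub_apply, smul_eq_mul, coeff_D]
      push_cast
      ring
    refine ih (N.sub_mem (N.lie_mem (x := gD) hv) (N.smul_mem (d - a₀ - b₀ - n₀) hv)) ?_ ?_ ?_
    · rw [hco]
      refine mul_ne_zero ?_ h0
      rw [add_zero, add_zero, Nat.cast_zero, sub_zero]
      exact Nat.cast_ne_zero.2 hi
    · intro a b c n hne
      rw [hco] at hne
      exact h a b c n (right_ne_zero_of_mul hne)
    · intro a b c n hne hne'
      rw [hco] at hne
      refine (Finset.mem_insert.1 (hs a b c n (right_ne_zero_of_mul hne) hne')).resolve_left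
        fun heq => left_ne_zero_of_mul hne ?_
      simp only [Prod.mk.injEq] at heq
      obtain ⟨rfl, rfl, rfl, rfl⟩ := heq
      exact sub_self _

/-- Among the nonsingular indices where `v` has a coefficient, take one of maximal total degree and
shift it to the vacuum. Maximality removes all other nonsingular contributions, and the singular
ones land in D-weights different from d. -/
theorem le_maxSubmodule (hN : N ≠ ⊤) : N ≤ maxSubmodule d r hθ := by
  intro v hv
  by_contra hv'
  apply hN
  apply eq_top_of_ket_mem
  let T : Set (ℕ × ℕ × ℕ × ℕ) :=
    {i | ¬ IsSingularDegree d i.2.2.2 ∧ coeff d r hθ v i.1 i.2.1 i.2.2.1 i.2.2.2 ≠ 0}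
  have hT : T.Finite := (finite_coeff_ne_zero hθ v).subset fun i hi => hi.2
  have hTne : T.Nonempty := by
    rw [mem_maxSubmodule] at hv'
    push Not at hv'
    obtain ⟨a, b, c, n, hn, h⟩ := hv'
    exact ⟨(a, b, c, n), hn, h⟩
  obtain ⟨⟨a₀, b₀, c₀, n₀⟩, ⟨hn₀, hne₀⟩, hmax⟩ :=
    hT.exists_maximalFor (fun i => i.1 + i.2.1 + i.2.2.1 + i.2.2.2) T hTne
  obtain ⟨w, hw, h⟩ := exists_shift hθ hv a₀ b₀ c₀ n₀
  refine ket_mem_of_coeff_ne_zero hθ hw ?_ ?_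
  · rw [h]
    simp only [zero_add]
    -- A vanishing factor k − 2d − 2 with k < n₀ would make n₀ a singular degree.
    refine mul_ne_zero (Finset.prod_ne_zero_iff.2 fun k hk h0 => hn₀ ⟨k, Finset.mem_range.1 hk, ?_⟩)
      hne₀
    linear_combination h0
  · intro a b c n hne hne'
    rw [h] at hne
    by_cases hs : IsSingularDegree d (n + n₀)
    · obtain ⟨k, hk, hkd⟩ := hs
      -- If n ≤ k, then the shift product contains the zero factor k − 2d − 2. Hence n > k ≥ 0, and
      -- the D-weight differs from d.
      have hkn : k < n := by
        by_contra hkn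
        refine left_ne_zero_of_mul hne (Finset.prod_eq_zero (i := k - n) ?_ ?_)
        · rw [Finset.mem_range]; omega
        · rw [Nat.add_sub_cancel' (not_lt.1 hkn), hkd]; ring
      omega
    · have hmem : (a + a₀, b + b₀, c + c₀, n + n₀) ∈ T := ⟨hs, right_ne_zero_of_mul hne⟩
      have := hmax hmem (by dsimp only; omega)
      dsimp only at this
      exfalso
      apply hne'
      simp only [Prod.mk.injEq]
      omega

end Reduction

/-! ### The simple quotient and its uniqueness -/

section Quotient

variable {Q : Type*} [AddCommGroup Q] [Module ℂ Q] [LieRingModule ECGA Q]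
  (hθ : θ ≠ 0) {π : Verma d r θ →ₗ⁅ℂ,ECGA⁆ Q}

theorem ket_notMem_maxSubmodule : ket d r θ ∉ maxSubmodule d r hθ :=
  fun h => maxSubmodule_ne_top hθ (eq_top_of_ket_mem h)

theorem map_ket_ne_zero (hker : π.ker = maxSubmodule d r hθ) : π (ket d r θ) ≠ 0 := by
  rw [ne_eq, ← LieModuleHom.mem_ker, hker]
  exact ket_notMem_maxSubmodule hθ

theorem isHighestWeightModule_of_surjective (hπ : Function.Surjective π)
    (hker : π.ker = maxSubmodule d r hθ) : IsHighestWeightModule Q d r θ := by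
  have h := isHighestWeightVector_ket (ket_ne_zero (d := d) (r := r) hθ)
  refine ⟨π (ket d r θ), ⟨map_ket_ne_zero hθ hker, ?_, ?_, ?_, ?_, ?_, ?_, ?_⟩, ?_⟩
  · rw [← LieModuleHom.map_lie, h.lie_D, map_smul]
  · rw [← LieModuleHom.map_lie, h.lie_J, map_smul]
  · rw [← LieModuleHom.map_lie, h.lie_Theta, map_smul]
  · rw [← LieModuleHom.map_lie, h.lie_H, map_zero]
  · rw [← LieModuleHom.map_lie, h.lie_Pplus, map_zero]
  · rw [← LieModuleHom.map_lie, h.lie_Pminus, map_zero]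
  · rw [← LieModuleHom.map_lie, h.lie_Kplus, map_zero]
  · rw [eq_top_iff]
    rintro q -
    obtain ⟨v, rfl⟩ := hπ q
    have : (LieSubmodule.lieSpan ℂ ECGA {π (ket d r θ)}).comap π = ⊤ :=
      eq_top_of_ket_mem (LieSubmodule.mem_comap.2
        (LieSubmodule.subset_lieSpan (Set.mem_singleton _)))
    exact LieSubmodule.mem_comap.1 (this ▸ LieSubmodule.mem_top v)

theorem isIrreducible_of_surjective (hπ : Function.Surjective π)
    (hker : π.ker = maxSubmodule d r hθ) : LieModule.IsIrreducible ℂ ECGA Q := by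
  have : Nontrivial Q := ⟨⟨_, _, map_ket_ne_zero hθ hker⟩⟩
  refine LieModule.IsIrreducible.mk fun N hN => ?_
  by_contra hNtop
  apply hN
  have hcomap : N.comap π ≠ ⊤ := by
    intro h
    apply hNtop
    rw [eq_top_iff]
    rintro q -
    obtain ⟨v, rfl⟩ := hπ q
    exact LieSubmodule.mem_comap.1 (h ▸ LieSubmodule.mem_top v)
  rw [eq_bot_iff]
  intro q hq
  obtain ⟨v, rfl⟩ := hπ q
  have hv := le_maxSubmodule hθ hcomap (LieSubmodule.mem_comap.2 hq)
  rw [← hker, LieModuleHom.mem_ker] at hv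
  rw [hv]
  exact LieSubmodule.zero_mem _

theorem not_finiteDimensional_of_ker_eq (hker : π.ker = maxSubmodule d r hθ) :
    ¬ FiniteDimensional ℂ Q := by
  intro hfin
  -- Powers of F₋ on the generator have n = 0, which is never singular, so they stay independent in
  -- the quotient.
  let e : ℕ → Verma d r θ := fun k => monomial d r θ (k, 0, 0, 0)
  have he : LinearIndependent ℂ fun k => π (e k) := by
    rw [linearIndependent_iff']
    intro s g hg k hk
    have hsum : ∑ i ∈ s, g i • e i ∈ maxSubmodule d r hθ := by
      rw [← hker, LieModuleHom.mem_ker, map_sum, ← hg]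
      exact Finset.sum_congr rfl fun i _ => map_smul _ _ _
    have h0 := hsum k 0 0 0 not_isSingularDegree_zero
    rw [map_sum, Finset.sum_apply, Finset.sum_apply, Finset.sum_apply, Finset.sum_apply,
      Finset.sum_eq_single k] at h0
    · obtain ⟨t, ht, h⟩ := hasMonomialCoeff_monomial (d := d) (r := r) hθ (k, 0, 0, 0)
      rw [map_smul] at h0
      simp only [Pi.smul_apply, smul_eq_mul, e, h, if_true] at h0
      exact (mul_eq_zero.1 h0).resolve_right ht
    · intro i _ hi
      obtain ⟨t, -, h⟩ := hasMonomialCoeff_monomial (d := d) (r := r) hθ (i, 0, 0, 0)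
      rw [map_smul]
      simp [e, h, hi.symm]
    · exact fun h => absurd hk h
  exact Module.Finite.not_linearIndependent_of_infinite _ he

/-- The simple highest weight module of a given weight is unique. -/
theorem nonempty_equiv (hπ : Function.Surjective π) (hker : π.ker = maxSubmodule d r hθ)
    {M : Type*} [AddCommGroup M] [Module ℂ M] [LieRingModule ECGA M] [LieModule ℂ ECGA M]
    (hM : IsHighestWeightModule M d r θ) (hirr : LieModule.IsIrreducible ℂ ECGA M) :
    Nonempty (M ≃ₗ⁅ℂ,ECGA⁆ Q) := by
  obtain ⟨v, hv, hspan⟩ := hM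
  obtain ⟨f, hf⟩ := exists_hom hv
  have hfsurj : Function.Surjective f := by
    have : LieSubmodule.lieSpan ℂ ECGA {v} ≤ f.range :=
      LieSubmodule.lieSpan_le.2 (Set.singleton_subset_iff.2 ⟨_, hf⟩)
    rw [hspan] at this
    intro m
    exact (LieModuleHom.mem_range f m).1 (this (LieSubmodule.mem_top m))
  have hfker : f.ker ≠ ⊤ := by
    intro h
    apply hv.ne_zero
    rw [← hf, ← LieModuleHom.mem_ker, h]
    exact LieSubmodule.mem_top _
  have hle : f.ker ≤ maxSubmodule d r hθ := le_maxSubmodule hθ hfker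
  have hge : maxSubmodule d r hθ ≤ f.ker := by
    have hmap : (maxSubmodule d r hθ).map f = ⊥ := by
      by_contra hne
      have htop := (eq_bot_or_eq_top _).resolve_left hne
      have hvmem : v ∈ (maxSubmodule d r hθ).map f := htop ▸ LieSubmodule.mem_top v
      obtain ⟨w, hw, hwv⟩ := (LieSubmodule.mem_map v).1 hvmem
      -- If the image of `maxSubmodule` were all of M, the generator would differ from some `w` in
      -- it by a kernel element, which also lies in `maxSubmodule`.
      have hsub : ket d r θ - w ∈ f.ker := by
        rw [LieModuleHom.mem_ker, map_sub, hf, hwv, sub_self]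
      have := (maxSubmodule d r hθ).add_mem (hle hsub) hw
      rw [sub_add_cancel] at this
      exact ket_notMem_maxSubmodule hθ this
    intro w hw
    rw [LieModuleHom.mem_ker, ← LieSubmodule.mem_bot (R := ℂ) (L := ECGA), ← hmap]
    exact LieSubmodule.mem_map_of_mem hw
  have hk : LinearMap.ker (f : Verma d r θ →ₗ[ℂ] M) = LinearMap.ker (π : Verma d r θ →ₗ[ℂ] Q) := by
    ext w
    rw [LinearMap.mem_ker, LinearMap.mem_ker]
    change f w = 0 ↔ π w = 0
    rw [← LieModuleHom.mem_ker, ← LieModuleHom.mem_ker, hker, le_antisymm hle hge]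
  let e : M ≃ₗ[ℂ] Q :=
    ((f : Verma d r θ →ₗ[ℂ] M).quotKerEquivOfSurjective hfsurj).symm ≪≫ₗ
      Submodule.quotEquivOfEq _ _ hk ≪≫ₗ
      (π : Verma d r θ →ₗ[ℂ] Q).quotKerEquivOfSurjective hπ
  have he : ∀ w, e (f w) = π w := by
    intro w
    have : ((f : Verma d r θ →ₗ[ℂ] M).quotKerEquivOfSurjective hfsurj).symm (f w) =
        Submodule.Quotient.mk w := by
      rw [LinearEquiv.symm_apply_eq]
      rfl
    simp only [e, LinearEquiv.trans_apply, this]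
    rfl
  refine ⟨{ e with map_lie' := ?_ }⟩
  intro x m
  obtain ⟨w, rfl⟩ := hfsurj m
  change e ⁅x, f w⁆ = ⁅x, e (f w)⁆
  rw [← LieModuleHom.map_lie, he, he, LieModuleHom.map_lie]

end Quotient

/-! ### The singular vector -/

section Singular

theorem maxSubmodule_eq_bot (hθ : θ ≠ 0) (h : ¬ ∃ p : ℕ, 0 < p ∧ (p : ℂ) = 2 * d + 3) :
    maxSubmodule d r hθ = ⊥ := by
  rw [eq_bot_iff]
  intro v hv
  rw [LieSubmodule.mem_bot]
  apply coeff_injective hθ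
  rw [map_zero]
  funext a b c n
  refine hv a b c n ?_
  rintro ⟨k, -, hk⟩
  refine h ⟨k + 1, k.succ_pos, ?_⟩
  rw [Nat.cast_add_one, hk]
  ring

variable {p : ℕ} (hp : 0 < p) (hpd : (p : ℂ) = 2 * d + 3)
include hp hpd

theorem isSingularDegree_iff {n : ℕ} : IsSingularDegree d n ↔ p ≤ n := by
  constructor
  · rintro ⟨k, hk, h⟩
    have : (p : ℂ) = ((k + 1 : ℕ) : ℂ) := by
      rw [Nat.cast_add_one, h, hpd]; ring
    have := Nat.cast_injective this
    omega
  · intro h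
    refine ⟨p - 1, by omega, ?_⟩
    rw [Nat.cast_sub hp, hpd]
    push_cast
    ring

omit hp hpd in
theorem singularVector_eq_monomial : singularVector d r θ p = monomial d r θ (0, 0, 0, p) :=
  singularVector_eq p

theorem isHighestWeightVector_singularVector (hθ : θ ≠ 0) :
    IsHighestWeightVector (d - p) r θ (singularVector d r θ p) := by
  rw [singularVector_eq_monomial]
  obtain ⟨t, ht, h⟩ := hasMonomialCoeff_monomial (d := d) (r := r) hθ (0, 0, 0, p)
  have ext_coeff : ∀ {v w : Verma d r θ},
      (∀ a b c n, coeff d r hθ v a b c n = coeff d r hθ w a b c n) → v = w := by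
    intro v w h
    apply coeff_injective hθ
    funext a b c n
    exact h a b c n
  refine ⟨?_, ?_, ?_, ?_, ?_, ?_, ?_, ?_⟩
  · intro h0
    have := h 0 0 0 p
    rw [h0, map_zero, if_pos rfl] at this
    exact ht this.symm
  · refine ext_coeff fun a b c n => ?_
    rw [coeff_D, map_smul]
    simp only [Pi.smul_apply, h, smul_eq_mul, Prod.mk.injEq]
    split_ifs with hi
    · obtain ⟨rfl, rfl, rfl, rfl⟩ := hi
      simp
    · simp
  · refine ext_coeff fun a b c n => ?_
    rw [coeff_J, map_smul]
    simp only [Pi.smul_apply, h, smul_eq_mul, Prod.mk.injEq]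
    split_ifs with hi
    · obtain ⟨rfl, rfl, rfl, rfl⟩ := hi
      simp
    · simp
  · rw [← act_apply, act_Theta]
    rfl
  · refine ext_coeff fun a b c n => ?_
    rw [coeff_H, map_zero]
    simp only [h, Prod.mk.injEq, Nat.add_eq_zero_iff, one_ne_zero, and_false, false_and, if_false,
      mul_zero, add_zero, sub_zero, Pi.zero_apply, mul_ite]
    split_ifs with hi
    -- H reads the component n + 1 = p, where its factor n − 2d − 2 equals p − (2d + 3) = 0.
    · have hn : (p : ℂ) = n + 1 := by rw [← hi.2.2.2, Nat.cast_add_one]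
      linear_combination t * (hpd - hn)
    · rfl
  · refine ext_coeff fun a b c n => ?_
    rw [coeff_Pplus, map_zero, h]
    simp
  · refine ext_coeff fun a b c n => ?_
    rw [coeff_Pminus, map_zero, h]
    simp
  · refine ext_coeff fun a b c n => ?_
    rw [coeff_Kplus, map_zero, h]
    simp

/-- `maxSubmodule` is spanned by the monomials with n ≥ p, and all of these are reached from the
singular vector by `lowering` and the creation operators. -/
theorem singularSubmodule_eq (hθ : θ ≠ 0) :
    singularSubmodule d r θ p = maxSubmodule d r hθ := by
  apply le_antisymm
  · refine LieSubmodule.lieSpan_le.2 (Set.singleton_subset_iff.2 ?_)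
    intro a b c n hn
    obtain ⟨t, -, h⟩ := hasMonomialCoeff_monomial (d := d) (r := r) hθ (0, 0, 0, p)
    rw [singularVector_eq_monomial, h, if_neg]
    rintro h
    simp only [Prod.mk.injEq] at h
    exact hn ((isSingularDegree_iff hp hpd).2 h.2.2.2.ge)
  · intro v hv
    refine mem_of_monomial_mem hθ (N := (singularSubmodule d r θ p).toSubmodule)
      fun a b c n hne => ?_
    have hn : p ≤ n := by
      rw [← isSingularDegree_iff hp hpd]
      by_contra hn
      exact hne (hv a b c n hn)
    clear hne
    change monomial d r θ (a, b, c, n) ∈ singularSubmodule d r θ p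
    induction a with
    | succ a ih => rw [← Fminus_monomial]; exact LieSubmodule.lie_mem _ ih
    | zero =>
    induction b with
    | succ b ih => rw [← Fplus_monomial]; exact LieSubmodule.lie_mem _ ih
    | zero =>
    induction c with
    | succ c ih => rw [← Kminus_monomial]; exact LieSubmodule.lie_mem _ ih
    | zero =>
    induction n, hn using Nat.le_induction with
    | base =>
      rw [← singularVector_eq_monomial]
      exact LieSubmodule.subset_lieSpan (Set.mem_singleton _)
    | succ n hn ih =>
      rw [← lowering_monomial, lowering_apply]
      exact add_mem (sub_mem (SMulMemClass.smul_mem _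
        (LieSubmodule.lie_mem _ ih)) (LieSubmodule.lie_mem _ (LieSubmodule.lie_mem _ ih)))
        (LieSubmodule.lie_mem _ (LieSubmodule.lie_mem _ ih))

end Singular

end Verma

end ECGA

end

theorem theorem2 (d r θ : ℂ) (hθ : θ ≠ 0) :
    ((¬ ∃ p : ℕ, 0 < p ∧ (p : ℂ) = 2 * d + 3) →
      ECGA.IsHighestWeightModule (ECGA.Verma d r θ) d r θ ∧
      LieModule.IsIrreducible ℂ ECGA (ECGA.Verma d r θ) ∧
      ¬ FiniteDimensional ℂ (ECGA.Verma d r θ) ∧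
      ∀ (M : Type*) [AddCommGroup M] [Module ℂ M] [LieRingModule ECGA M] [LieModule ℂ ECGA M],
        ECGA.IsHighestWeightModule M d r θ → LieModule.IsIrreducible ℂ ECGA M →
          Nonempty (M ≃ₗ⁅ℂ,ECGA⁆ ECGA.Verma d r θ)) ∧
    (∀ p : ℕ, 0 < p → (p : ℂ) = 2 * d + 3 →
      ECGA.IsHighestWeightVector (d - p) r θ (ECGA.singularVector d r θ p) ∧
      (ECGA.singularSubmodule d r θ p : Set (ECGA.Verma d r θ)) =
        Set.range (fun u : UniversalEnvelopingAlgebra ℂ ECGA.gMinus =>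
          ECGA.minusAction (ECGA.Verma d r θ) u (ECGA.singularVector d r θ p)) ∧
      ECGA.IsHighestWeightModule (ECGA.VermaQuotient d r θ p) d r θ ∧
      LieModule.IsIrreducible ℂ ECGA (ECGA.VermaQuotient d r θ p) ∧
      ¬ FiniteDimensional ℂ (ECGA.VermaQuotient d r θ p) ∧
      ∀ (M : Type*) [AddCommGroup M] [Module ℂ M] [LieRingModule ECGA M] [LieModule ℂ ECGA M],
        ECGA.IsHighestWeightModule M d r θ → LieModule.IsIrreducible ℂ ECGA M →
          Nonempty (M ≃ₗ⁅ℂ,ECGA⁆ ECGA.VermaQuotient d r θ p)) := by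
  refine ⟨fun h => ?_, fun p hp hpd => ?_⟩
  -- Here `maxSubmodule` is zero, so the identity serves as the projection to the simple quotient.
  · have hker : (LieModuleHom.id : ECGA.Verma d r θ →ₗ⁅ℂ,ECGA⁆ ECGA.Verma d r θ).ker =
        ECGA.Verma.maxSubmodule d r hθ := by
      rw [ECGA.Verma.maxSubmodule_eq_bot hθ h]
      exact LieModuleHom.ker_id
    have hsurj : Function.Surjective
        (LieModuleHom.id : ECGA.Verma d r θ →ₗ⁅ℂ,ECGA⁆ ECGA.Verma d r θ) := fun v => ⟨v, rfl⟩
    exact ⟨ECGA.Verma.isHighestWeightModule_of_surjective hθ hsurj hker,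
      ECGA.Verma.isIrreducible_of_surjective hθ hsurj hker,
      ECGA.Verma.not_finiteDimensional_of_ker_eq hθ hker,
      fun M _ _ _ _ hM hirr => ECGA.Verma.nonempty_equiv hθ hsurj hker hM hirr⟩
  · have hv := ECGA.Verma.isHighestWeightVector_singularVector (r := r) hp hpd hθ
    have hker : (LieSubmodule.Quotient.mk' (ECGA.singularSubmodule d r θ p)).ker =
        ECGA.Verma.maxSubmodule d r hθ := by
      rw [LieSubmodule.Quotient.mk'_ker, ECGA.Verma.singularSubmodule_eq hp hpd hθ]
    have hsurj := LieSubmodule.Quotient.surjective_mk' (ECGA.singularSubmodule d r θ p)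
    exact ⟨hv, hv.coe_lieSpan,
      ECGA.Verma.isHighestWeightModule_of_surjective hθ hsurj hker,
      ECGA.Verma.isIrreducible_of_surjective hθ hsurj hker,
      ECGA.Verma.not_finiteDimensional_of_ker_eq hθ hker,
      fun M _ _ _ _ hM hirr => ECGA.Verma.nonempty_equiv hθ hsurj hker hM hirr⟩
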